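/- All algebras and modules are finite-dimensional over $\mathbb C$. Let $\mathcal N$ be a nilpotent Lie algebra and $\mathcal T\subseteq\operatorname{Der}(\mathcal N)$ a maximal torus, i.e. a subalgebra that is maximal among the abelian subalgebras consisting of diagonalizable derivations. Let $\mathcal R_{\mathcal T}=\mathcal N\rtimes\mathcal T$, and for $\alpha\in\mathcal T^*$ put $\mathcal N_\alpha=\{x\in\mathcal N : t(x)=\alpha(t)x\ \text{for all } t\in\mathcal T\}$. Let $W=\{\alpha\in\mathcal T^* : \mathcal N_\alpha\ne 0\}$ be the set of weights, and let $\Pi\subseteq W$ be the set of primitive weights, i.e. the weights of $\mathcal T$ on $\mathcal N/[\mathcal N,\mathcal N]$. Assume that (a) $\dim\mathcal T=\dim(\mathcal N/[\mathcal N,\mathcal N])$ (maximal rank); (b) $\dim\mathcal N_\alpha=1$ for every $\alpha\in W$, and $[\mathcal N_\alpha,\mathcal N_\beta]=\mathcal N_{\alpha+\beta}$ whenever $\alpha\neq\beta$ and $\alpha,\beta,\alpha+\beta\in W$. Suppose that every weight $\lambda\in W$ satisfies at least one of the following three conditions. (i) (Leger–Luks condition) Whenever $\lambda=\alpha+\gamma=\beta+\delta$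 with $\alpha,\beta\in\Pi$ distinct and $\gamma,\delta\in W$, there is $\mu\in W$ with $\delta=\alpha+\mu$ and $\gamma=\beta+\mu$ such that at least one of the following holds: $\alpha+\beta\notin W$; or $\alpha+\beta\in W$, $\alpha+2\beta\notin W$ and $\mu=\beta+\nu$ for some $\nu\in W$; or $\alpha+\beta\in W$, $2\alpha+\beta\notin W$ and $\mu=\alpha+\nu$ for some $\nu\in W$. (ii) $\lambda=\alpha_i+\mu$ for some $\alpha_i\in\Pi$ and $\mu\in W$, and $\lambda-\alpha_j\notin W$ for all $\alpha_j\in\Pi\setminus\{\alpha_i\}$. (iii) $\lambda=\alpha_i+\alpha_j$ or $\lambda=2\alpha_i+\alpha_j$ for some distinct $\alpha_i,\alpha_j\in\Pi$. Then: 1. For every $\mathcal R_{\mathcal T}$-module $\mathcal M$ on which $\mathcal T$ acts diagonally and all of whose $\mathcal T$-weights lie in $W$, one has $H^2(\mathcal N,\mathcal M)^{\mathcal T}=0$. Here $H^2(\mathcal N,\mathcal M)$ is Chevalley–Eilenberg cohomology, on which $t\in\mathcal T$ acts by $(t\cdot f)(x,y)=t\cdot f(x,y)-f([t,x],y)-f(x,[t,y])$,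 and $H^2(\mathcal N,\mathcal M)^{\mathcal T}$ is the space of classes annihilated by $\mathcal T$. 2. $\mathcal R_{\mathcal T}$ is cohomologically rigid, i.e. $H^2(\mathcal R_{\mathcal T},\mathcal R_{\mathcal T})=0$. -/

import Mathlib

namespace MaxRank

/-! ### Second Chevalley-Eilenberg cohomology

The low degree cochains, the differentials `d₁₂`, `d₂₃` and the cocycles are Mathlib's. -/

section Cohomology

open LieModule.Cohomology

variable (L : Type*) [LieRing L] [LieAlgebra ℂ L]
variable (M : Type*) [AddCommGroup M] [Module ℂ M]

/-- The alternating 2-cochains `C²(L, M) = Hom(Λ² L, M)`, as a vector space. -/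
def C2 : Type _ := twoCochain ℂ L M

instance : AddCommGroup (C2 L M) := inferInstanceAs (AddCommGroup (twoCochain ℂ L M))

instance : Module ℂ (C2 L M) := inferInstanceAs (Module ℂ (twoCochain ℂ L M))

instance : FunLike (C2 L M) L (L →ₗ[ℂ] M) :=
  inferInstanceAs (FunLike (twoCochain ℂ L M) L (L →ₗ[ℂ] M))

variable {L M} in
theorem C2.ext' {f g : C2 L M} (h : ∀ x y, f x y = g x y) : f = g :=
  DFunLike.ext _ _ fun x => LinearMap.ext (h x)

variable {L M} in
theorem ev_add_left (f : C2 L M) (x x' : L) : f (x + x') = f x + f x' :=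
  map_add (show twoCochain ℂ L M from f) x x'

variable {L M} in
theorem ev_smul_left (f : C2 L M) (c : ℂ) (x : L) : f (c • x) = c • f x :=
  map_smul (show twoCochain ℂ L M from f) c x

variable {L M} in
theorem ev_self (f : C2 L M) (x : L) : f x x = 0 :=
  twoCochain_alt (show twoCochain ℂ L M from f) x

variable {L M} in
theorem ev_skew (f : C2 L M) (x y : L) : f x y = -f y x :=
  (twoCochain_skew (show twoCochain ℂ L M from f) y x).symm

variable [LieRingModule L M] [LieModule ℂ L M]

/-- The cocycles `Z²(L, M)`, the kernel of `d² : C²(L, M) → C³(L, M)`. -/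
def Z2 : Submodule ℂ (C2 L M) := twoCocycle ℂ L M

/-- The coboundaries `B²(L, M)`, the image of `d¹ : C¹(L, M) → C²(L, M)`. -/
def B2 : Submodule ℂ (C2 L M) := LinearMap.range (d₁₂ ℂ L M)

/-- The second cohomology `H²(L, M) = Z²(L, M) / B²(L, M)`. -/
abbrev H2 : Type _ := Z2 L M ⧸ (B2 L M).submoduleOf (Z2 L M)

/-- A Lie algebra is cohomologically rigid if `H²(L, L) = 0`. -/
def CohomologicallyRigid (L : Type*) [LieRing L] [LieAlgebra ℂ L] : Prop :=
  Subsingleton (H2 L L)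

end Cohomology

/-! ### Maximal tori, weights and the algebra `N ⋊ T` -/

section Torus

variable {N : Type*} [LieRing N] [LieAlgebra ℂ N]

/-- A torus of `N`: an abelian Lie algebra of diagonalizable derivations of `N`. -/
def IsTorus (T : LieSubalgebra ℂ (LieDerivation ℂ N N)) : Prop :=
  (∀ D ∈ T, ∀ E ∈ T, ⁅D, E⁆ = 0) ∧
    ∀ D ∈ T, ⨆ c : ℂ, Module.End.eigenspace (D : N →ₗ[ℂ] N) c = ⊤

/-- A maximal torus of `N`: maximal for inclusion among the tori of `N`. -/
def IsMaximalTorus (T : LieSubalgebra ℂ (LieDerivation ℂ N N)) : Prop := Maximal IsTorus T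

variable (N) in
/-- The derived ideal `N² = [N, N]`. -/
abbrev derivedIdeal : LieIdeal ℂ N := ⁅(⊤ : LieIdeal ℂ N), (⊤ : LieIdeal ℂ N)⁆

variable (T : LieSubalgebra ℂ (LieDerivation ℂ N N))

/-- The semidirect product `N ⋊ T`, in which `[t, x] = t x` for `t ∈ T` and `x ∈ N`. -/
abbrev SolvExt : Type _ := LieAlgebra.SemiDirectSum N T T.incl

/-- The inclusion of `N` into `N ⋊ T`. -/
abbrev inN : N →ₗ⁅ℂ⁆ SolvExt T := LieAlgebra.SemiDirectSum.inl T.incl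

/-- The inclusion of `T` into `N ⋊ T`. -/
abbrev inT : T →ₗ⁅ℂ⁆ SolvExt T := LieAlgebra.SemiDirectSum.inr T.incl

/-- The weight space `N_α = {x | t x = α(t) x for all t ∈ T}`, for a linear form `α` on `T`. -/
def rootSpace (α : Module.Dual ℂ T) : Submodule ℂ N where
  carrier := {x | ∀ t : T, (t : LieDerivation ℂ N N) x = α t • x}
  add_mem' {x y} hx hy t := by rw [map_add, hx t, hy t, smul_add]
  zero_mem' t := by simp
  smul_mem' c x hx t := by rw [map_smul, hx t, smul_comm]

/-- The set `W` of weights of `T` on `N`. -/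
def W : Set (Module.Dual ℂ T) := {α | rootSpace T α ≠ ⊥}

/-- The set `Π` of primitive weights, i.e. the weights of `T` on `N / N²`: those whose weight
space is not contained in `N²`. -/
def primitive : Set (Module.Dual ℂ T) :=
  {α | α ∈ W T ∧ ¬ rootSpace T α ≤ (derivedIdeal N).toSubmodule}

/-- The standing assumptions on a solvable Lie algebra `N ⋊ T` of maximal rank: `N` is nilpotent, `T` is a maximal torus with `dim T = dim (N / N²)`, the weight spaces of `T` on `N` are
lines, and `[N_α, N_β] = N_{α+β}` whenever the distinct weights `α`, `β` have a sum in `W`. (For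
`α = β` the bracket of the line `N_α` with itself is `0`, so nothing can be asked.) -/
structure IsMaxRank : Prop where
  nilpotent : LieRing.IsNilpotent N
  maximalTorus : IsMaximalTorus T
  finrank_eq : Module.finrank ℂ T = Module.finrank ℂ (N ⧸ derivedIdeal N)
  finrank_rootSpace : ∀ α ∈ W T, Module.finrank ℂ (rootSpace T α) = 1
  bracket_eq : ∀ α ∈ W T, ∀ β ∈ W T, α ≠ β → α + β ∈ W T →
    Submodule.span ℂ {z | ∃ x ∈ rootSpace T α, ∃ y ∈ rootSpace T β, ⁅x, y⁆ = z} =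
      rootSpace T (α + β)

/-- The Leger-Luks condition for the weight `l`: it is imposed on every pair of decompositions
`l = α + γ = β + δ` with distinct primitive `α`, `β` and weights `γ`, `δ`. -/
def LegerLuks (l : Module.Dual ℂ T) : Prop :=
  ∀ α ∈ primitive T, ∀ β ∈ primitive T, α ≠ β → ∀ γ ∈ W T, ∀ δ ∈ W T,
    l = α + γ → l = β + δ →
    ∃ μ ∈ W T, δ = α + μ ∧ γ = β + μ ∧
      (α + β ∉ W T ∨
        (α + β ∈ W T ∧ α + (2 : ℂ) • β ∉ W T ∧ ∃ ν ∈ W T, μ = β + ν) ∨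
        (α + β ∈ W T ∧ (2 : ℂ) • α + β ∉ W T ∧ ∃ ν ∈ W T, μ = α + ν))

/-- `l = α + μ` with `α` primitive and `μ` a weight, and no other primitive weight can be
subtracted from `l`. -/
def UniqueDecomposition (l : Module.Dual ℂ T) : Prop :=
  ∃ α ∈ primitive T, (∃ μ ∈ W T, l = α + μ) ∧ ∀ β ∈ primitive T, β ≠ α → l - β ∉ W T

/-- `l = α + β` or `l = α + (α + β)` for distinct primitive weights `α`, `β`. -/
def ShortWeight (l : Module.Dual ℂ T) : Prop :=
  ∃ α ∈ primitive T, ∃ β ∈ primitive T, α ≠ β ∧ (l = α + β ∨ l = α + (α + β))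

end Torus

/-! ### Modules over `N ⋊ T` and the invariants `H²(N, M)^T` -/

section Invariants

open LieModule.Cohomology

variable {N : Type*} [LieRing N] [LieAlgebra ℂ N]
variable (T : LieSubalgebra ℂ (LieDerivation ℂ N N))
variable (M : Type*) [AddCommGroup M] [Module ℂ M]
variable [LieRingModule (SolvExt T) M] [LieModule ℂ (SolvExt T) M]

/-- The weight space of `T` on `M` for a linear form `α` on `T`. -/
def weightSpace (α : Module.Dual ℂ T) : Submodule ℂ M where
  carrier := {m | ∀ t : T, ⁅inT T t, m⁆ = α t • m}
  add_mem' {x y} hx hy t := by rw [lie_add, hx t, hy t, smul_add]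
  zero_mem' t := by simp
  smul_mem' c x hx t := by rw [lie_smul, hx t, smul_comm]

/-- The action of `T` on `M` is diagonal: `M` is the sum of its weight spaces. -/
def IsDiagonalModule : Prop := ⨆ α : Module.Dual ℂ T, weightSpace T M α = ⊤

/-- All weights of `T` on `M` belong to `W`. -/
def WeightsIn : Prop := ∀ α : Module.Dual ℂ T, weightSpace T M α ≠ ⊥ → α ∈ W T

/-- `M` as an `N`-module, by restriction along the inclusion of `N` into `N ⋊ T`. -/
abbrev resLieRingModule : LieRingModule N M := LieRingModule.compLieHom M (inN T)

theorem resLieModule : letI := resLieRingModule T M; LieModule ℂ N M :=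
  LieModule.compLieHom M (inN T)

/-- The cocycles `Z²(N, M)`. -/
def cocyclesN : Submodule ℂ (C2 N M) :=
  @Z2 N _ _ M _ _ (resLieRingModule T M) (resLieModule T M)

/-- The coboundaries `B²(N, M)`. -/
def coboundariesN : Submodule ℂ (C2 N M) :=
  @B2 N _ _ M _ _ (resLieRingModule T M) (resLieModule T M)

/-- The cohomology `H²(N, M) = Z²(N, M) / B²(N, M)`. -/
abbrev H2N : Type _ := cocyclesN T M ⧸ (coboundariesN T M).submoduleOf (cocyclesN T M)

/-- The action of `t ∈ T` on `C²(N, M)`: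
`(t • f)(x, y) = t • f(x, y) - f([t, x], y) - f(x, [t, y])`. -/
def cochainAct (t : T) : C2 N M →ₗ[ℂ] C2 N M where
  toFun f := show twoCochain ℂ N M from
    { val := LinearMap.mk₂ ℂ
        (fun x y => ⁅inT T t, f x y⁆ - f ((t : LieDerivation ℂ N N) x) y
          - f x ((t : LieDerivation ℂ N N) y))
        (fun x x' y => by simp only [map_add, LinearMap.add_apply, lie_add, ev_add_left]; abel)
        (fun c x y => by
          simp only [map_smul, LinearMap.smul_apply, lie_smul, smul_sub, ev_smul_left])
        (fun x y y' => by simp only [map_add, lie_add]; abel)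
        (fun c x y => by simp only [map_smul, lie_smul, smul_sub])
      property := fun x => by
        simp only [LinearMap.mk₂_apply, ev_self, lie_zero, zero_sub]
        rw [ev_skew]; simp }
  map_add' f g := by
    refine C2.ext' fun x y => ?_
    change ⁅inT T t, f x y + g x y⁆ - (f _ y + g _ y) - (f x _ + g x _) =
      (⁅inT T t, f x y⁆ - f _ y - f x _) + (⁅inT T t, g x y⁆ - g _ y - g x _)
    rw [lie_add]; abel
  map_smul' c f := by
    refine C2.ext' fun x y => ?_
    change ⁅inT T t, c • f x y⁆ - c • f _ y - c • f x _ =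
      c • (⁅inT T t, f x y⁆ - f _ y - f x _)
    rw [lie_smul, smul_sub, smul_sub]

theorem cochainAct_apply (t : T) (f : C2 N M) (x y : N) :
    cochainAct T M t f x y = ⁅inT T t, f x y⁆ - f ((t : LieDerivation ℂ N N) x) y
      - f x ((t : LieDerivation ℂ N N) y) := rfl

theorem mem_cocyclesN (f : C2 N M) :
    f ∈ cocyclesN T M ↔ ∀ x y z : N,
      ⁅inN T x, f y z⁆ - ⁅inN T y, f x z⁆ + ⁅inN T z, f x y⁆
        - f ⁅x, y⁆ z + f ⁅x, z⁆ y - f ⁅y, z⁆ x = 0 := by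
  let _ := resLieRingModule T M
  have _ := resLieModule T M
  refine (mem_twoCocycle_iff ℂ N M f).trans ⟨fun h x y z => ?_, fun h => ?_⟩
  · exact LinearMap.congr_fun (LinearMap.congr_fun (LinearMap.congr_fun h x) y) z
  · ext x y z
    exact h x y z

theorem mem_coboundariesN (f : C2 N M) :
    f ∈ coboundariesN T M ↔ ∃ g : N →ₗ[ℂ] M, ∀ x y : N,
      f x y = ⁅inN T x, g y⁆ - ⁅inN T y, g x⁆ - g ⁅x, y⁆ := by
  let _ := resLieRingModule T M
  have _ := resLieModule T M
  constructor
  · rintro ⟨g, rfl⟩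
    exact ⟨g, fun x y => rfl⟩
  · rintro ⟨g, hg⟩
    exact ⟨g, C2.ext' fun x y => (hg x y).symm⟩

theorem inT_lie_inN (t : T) (x : N) (m : M) :
    ⁅inT T t, ⁅inN T x, m⁆⁆ =
      ⁅inN T ((t : LieDerivation ℂ N N) x), m⁆ + ⁅inN T x, ⁅inT T t, m⁆⁆ := by
  have h : ⁅inT T t, inN T x⁆ = inN T ((t : LieDerivation ℂ N N) x) := by
    simp
  rw [leibniz_lie, h]

theorem cochainAct_mem_cocyclesN (t : T) (f : C2 N M) (hf : f ∈ cocyclesN T M) :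
    cochainAct T M t f ∈ cocyclesN T M := by
  rw [mem_cocyclesN] at hf ⊢
  intro x y z
  have h0 := congrArg (fun m => ⁅inT T t, m⁆) (hf x y z)
  have h1 := hf ((t : LieDerivation ℂ N N) x) y z
  have h2 := hf x ((t : LieDerivation ℂ N N) y) z
  have h3 := hf x y ((t : LieDerivation ℂ N N) z)
  simp only [lie_add, lie_sub, lie_zero, inT_lie_inN] at h0
  simp only [cochainAct_apply, LieDerivation.apply_lie_eq_add, ev_add_left, lie_sub,
    LinearMap.add_apply]
  linear_combination (norm := module) h0 - h1 - h2 - h3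

theorem cochainAct_mem_coboundariesN (t : T) (f : C2 N M)
    (hf : f ∈ coboundariesN T M) : cochainAct T M t f ∈ coboundariesN T M := by
  rw [mem_coboundariesN] at hf ⊢
  obtain ⟨g, hg⟩ := hf
  refine ⟨(LieModule.toEnd ℂ (SolvExt T) M (inT T t)).comp g -
    g.comp ((t : LieDerivation ℂ N N) : N →ₗ[ℂ] N), fun x y => ?_⟩
  simp only [cochainAct_apply, hg, LinearMap.sub_apply, LinearMap.comp_apply,
    LieModule.toEnd_apply_apply, LieDerivation.coeFn_coe, LieDerivation.apply_lie_eq_add, map_add,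
    lie_sub, inT_lie_inN]
  module

/-- The action of `t ∈ T` on `Z²(N, M)`. -/
def cocycleAct (t : T) : cocyclesN T M →ₗ[ℂ] cocyclesN T M :=
  (cochainAct T M t).restrict (cochainAct_mem_cocyclesN T M t)

/-- The action of `t ∈ T` on `H²(N, M)`. -/
def cohomologyAct (t : T) : H2N T M →ₗ[ℂ] H2N T M :=
  Submodule.mapQ _ _ (cocycleAct T M t) fun f hf =>
    cochainAct_mem_coboundariesN T M t f hf

/-- The invariants `H²(N, M)^T = {c ∈ H²(N, M) | t • c = 0 for all t ∈ T}`. -/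
def H2Inv : Submodule ℂ (H2N T M) := ⨅ t : T, LinearMap.ker (cohomologyAct T M t)

end Invariants

end MaxRank

/-!
Rigidity of solvable Lie algebras of maximal rank whose weights satisfy the Leger-Luks condition or
one of its two substitutes.

The primitive weights `Π` form a basis of the dual of `T`: they separate the elements of `T`,
because the primitive weight spaces generate the nilpotent algebra `N`, and there are at most
`dim (N / N²) = dim T` of them. So every weight is a combination of primitive weights with
coefficients in `ℕ`, it has a positive height, and twice a primitive weight is not a weight.

*Cohomology of `N`.* An invariant class is represented by an invariant cocycle `f`, because `T` acts
by commuting semisimple operators (`exists_annihilated_sub_mem`). Such an `f` maps `N_α × N_β` into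
`M_{α+β}`, so only pairs with `α + β ∈ W` matter. As `N` raises heights, the components of `f` of
the lowest total height are cocycles with trivial coefficients, and these can be removed one height
after the other (`IsInvariantCocycle.exists_eq_coboundary`) as soon as every trivial-coefficients
cocycle of weight `l ∈ W` has the form `g [x, y]` (`IsCocycleAt.exists_eq_comp_lie`), i.e. as soon
as `N` has no defining relation of weight `l`. Since the primitive weight vectors generate `N`, such
a cocycle is determined by its values on the `N_α × N_γ` with `α` primitive and `α + γ = l`. One of
these values can be made zero by the choice of `g`; that the others then vanish is clear if there
are essentially no others, and follows from the Leger-Luks condition through the relations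
`[b, [b, a]] = 0` or `[a, [a, b]] = 0` (`IsCocycleAt.eq_zero_of_legerLuks`).

*Rigidity.* By Cartan's formula `T` acts trivially on the cohomology of `N ⋊ T`, so only invariant
cocycles `f` matter. For `t ∈ T` the derivation `f(t, ·)` preserves weights; it vanishes on `T`, and
on `N` it is the action of an element of `T`, as the rank is maximal. This disposes of the
components of `f` on `T × T` and `T × N`. The component on `N × N` is a coboundary by the result
for `N` with coefficients in `N ⋊ T`, whose only further weight `0` is not a sum of two weights of
`N` (`mem_B2_of_invariant`).
-/

namespace MaxRank

/-! ### Simultaneous diagonalization -/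

section Diagonalization

variable {V : Type*} [AddCommGroup V] [Module ℂ V] [FiniteDimensional ℂ V]

theorem isSemisimple_of_iSup_eigenspace_eq_top {f : Module.End ℂ V}
    (h : ⨆ c : ℂ, f.eigenspace c = ⊤) : f.IsSemisimple := by
  have hfin : {c : ℂ | f.eigenspace c ≠ ⊥}.Finite :=
    WellFoundedGT.finite_ne_bot_of_iSupIndep f.eigenspaces_iSupIndep
  let p : Polynomial ℂ := ∏ c ∈ hfin.toFinset, (Polynomial.X - Polynomial.C c)
  have hp : Squarefree p := by
    apply Polynomial.Separable.squarefree
    exact Polynomial.separable_prod_X_sub_C_iff'.2 fun x _ y _ h => h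
  refine Module.End.isSemisimple_of_squarefree_aeval_eq_zero hp ?_
  rw [← LinearMap.ker_eq_top, eq_top_iff, ← h, iSup_le_iff]
  intro c x hx
  rw [LinearMap.mem_ker,
    Module.End.aeval_apply_of_mem_apply_eq_smul (Module.End.mem_eigenspace_iff.1 hx)]
  by_cases h0 : f.eigenspace c = ⊥
  · rw [h0, Submodule.mem_bot] at hx
    simp [hx]
  · rw [Polynomial.eval_prod, Finset.prod_eq_zero (hfin.mem_toFinset.2 h0) (by simp), zero_smul]

end Diagonalization

section RootSpaces

variable {N : Type*} [LieRing N] [LieAlgebra ℂ N] {T : LieSubalgebra ℂ (LieDerivation ℂ N N)}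

theorem lie_mem_rootSpace {α β : Module.Dual ℂ T} {x y : N} (hx : x ∈ rootSpace T α)
    (hy : y ∈ rootSpace T β) : ⁅x, y⁆ ∈ rootSpace T (α + β) := fun t => by
  rw [LieDerivation.apply_lie_eq_add, hx t, hy t, lie_smul, smul_lie, ← add_smul,
    LinearMap.add_apply, add_comm]

theorem eq_zero_of_notMem_W {α : Module.Dual ℂ T} (hα : α ∉ W T) {x : N}
    (hx : x ∈ rootSpace T α) : x = 0 := by
  have h : rootSpace T α = ⊥ := not_not.1 hα
  rwa [h, Submodule.mem_bot] at hx

theorem mem_W_of_ne_zero {α : Module.Dual ℂ T} {x : N} (hx : x ∈ rootSpace T α) (h0 : x ≠ 0) :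
    α ∈ W T := not_not.1 fun h => h0 (eq_zero_of_notMem_W h hx)

theorem exists_mem_rootSpace_ne_zero {α : Module.Dual ℂ T} (hα : α ∈ W T) :
    ∃ x ∈ rootSpace T α, x ≠ 0 := (Submodule.ne_bot_iff _).1 hα

theorem commute_of_isTorus (hT : IsTorus T) (s t : T) :
    Commute ((s : LieDerivation ℂ N N) : Module.End ℂ N)
      ((t : LieDerivation ℂ N N) : Module.End ℂ N) := by
  have h := hT.1 s s.2 t t.2
  refine LinearMap.ext fun x => ?_
  have := congrArg (fun D : LieDerivation ℂ N N => D x) h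
  simp only [LieDerivation.lie_apply, LieDerivation.zero_apply] at this
  exact sub_eq_zero.1 this

variable [FiniteDimensional ℂ N]

theorem isSemisimple_of_isTorus (hT : IsTorus T) (t : T) :
    Module.End.IsSemisimple ((t : LieDerivation ℂ N N) : N →ₗ[ℂ] N) :=
  isSemisimple_of_iSup_eigenspace_eq_top (hT.2 t t.2)

theorem iSup_rootSpace (hT : IsTorus T) : ⨆ α, rootSpace T α = ⊤ := by
  have key := open Module.End in
    iSup_iInf_maxGenEigenspace_eq_top_of_iSup_maxGenEigenspace_eq_top_of_commute
    (fun t : T => ((t : LieDerivation ℂ N N) : Module.End ℂ N))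
    (fun s t _ => commute_of_isTorus hT s t)
    (fun t => (isSemisimple_of_isTorus hT t).iSup_maxGenEigenspace_eq_top_iff.2 (hT.2 t t.2))
  rw [eq_top_iff, ← key, iSup_le_iff]
  intro χ x hx
  have hx' : ∀ t : T, (t : LieDerivation ℂ N N) x = χ t • x := fun t => by
    have := (Submodule.mem_iInf _).1 hx t
    rw [(isSemisimple_of_isTorus hT t).isFinitelySemisimple.maxGenEigenspace_eq_eigenspace] at this
    exact Module.End.mem_eigenspace_iff.1 this
  by_cases h0 : x = 0
  · simp [h0]
  · let α : Module.Dual ℂ T :=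
      { toFun := χ
        map_add' := fun s t => smul_left_injective ℂ h0 (by
          change χ (s + t) • x = (χ s + χ t) • x
          rw [add_smul, ← hx', ← hx', ← hx']; rfl)
        map_smul' := fun c t => smul_left_injective ℂ h0 (by
          change χ (c • t) • x = (c * χ t) • x
          rw [mul_smul, ← hx', ← hx']; rfl) }
    exact Submodule.mem_iSup_of_mem (p := rootSpace T) α hx'

theorem iSupIndep_rootSpace (hT : IsTorus T) : iSupIndep (rootSpace T) := by
  have key := Module.End.independent_iInf_maxGenEigenspace_of_forall_mapsTo
    (fun t : T => ((t : LieDerivation ℂ N N) : Module.End ℂ N))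
    (fun s t c => Module.End.mapsTo_maxGenEigenspace_of_comm (commute_of_isTorus hT t s) c)
  have := key.comp (f := fun (α : Module.Dual ℂ T) (t : T) => α t)
    (fun α β h => LinearMap.ext (congrFun h))
  refine this.mono fun α x hx => ?_
  simp only [Function.comp, Submodule.mem_iInf]
  intro t
  rw [((isSemisimple_of_isTorus hT t).isFinitelySemisimple).maxGenEigenspace_eq_eigenspace]
  exact Module.End.mem_eigenspace_iff.2 (hx t)

theorem finite_W (hT : IsTorus T) : (W T).Finite :=
  WellFoundedGT.finite_ne_bot_of_iSupIndep (iSupIndep_rootSpace hT)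

theorem eq_top_of_rootSpace_le (hT : IsTorus T) {U : Submodule ℂ N}
    (h : ∀ α ∈ W T, rootSpace T α ≤ U) : U = ⊤ := by
  rw [eq_top_iff, ← iSup_rootSpace hT, iSup_le_iff]
  intro α
  by_cases hα : α ∈ W T
  · exact h α hα
  · exact fun x hx => by simp [eq_zero_of_notMem_W hα hx]

theorem W_subset_of_iSup_eq_top (hT : IsTorus T) {S : Set (Module.Dual ℂ T)}
    (h : ⨆ α ∈ S, rootSpace T α = ⊤) : W T ⊆ S := by
  intro α hα
  by_contra hS
  obtain ⟨x, hx, h0⟩ := exists_mem_rootSpace_ne_zero hα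
  refine h0 ((Submodule.disjoint_def.1 ((iSupIndep_rootSpace hT).disjoint_biSup hS)) x hx ?_)
  rw [h]; trivial

/-- A linear form on `N` that takes the value `1` at a given nonzero `x ∈ N_α` and vanishes on the
other weight spaces. -/
theorem exists_coord (hT : IsTorus T) {α : Module.Dual ℂ T} {x : N} (hx : x ∈ rootSpace T α)
    (h0 : x ≠ 0) :
    ∃ ξ : N →ₗ[ℂ] ℂ, ξ x = 1 ∧ ∀ β ≠ α, ∀ y ∈ rootSpace T β, ξ y = 0 := by
  have hx' : x ∉ ⨆ β, ⨆ (_ : β ≠ α), rootSpace T β := fun h =>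
    h0 (Submodule.disjoint_def.1 (iSupIndep_rootSpace hT α) x hx h)
  obtain ⟨ξ, h1, h2⟩ := Submodule.exists_le_ker_of_notMem hx'
  refine ⟨(ξ x)⁻¹ • ξ, by simp [h1], fun β hβ y hy => ?_⟩
  have : ξ y = 0 := h2 (Submodule.mem_iSup_of_mem β (Submodule.mem_iSup_of_mem hβ hy))
  simp [this]

end RootSpaces

/-! ### Weights of a Lie algebra of maximal rank -/

section Generators

variable {N : Type*} [LieRing N] [LieAlgebra ℂ N]

/-- A subalgebra that spans a nilpotent Lie algebra modulo the derived ideal is everything. -/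
theorem mem_of_sup_derivedIdeal_eq_top (hN : LieRing.IsNilpotent N) (A : LieSubalgebra ℂ N)
    (hA : A.toSubmodule ⊔ (derivedIdeal N).toSubmodule = ⊤) (x : N) : x ∈ A := by
  have key : ∀ k : ℕ,
      A.toSubmodule ⊔ (LieModule.lowerCentralSeries ℂ N N (k + 1)).toSubmodule = ⊤ := by
    intro k
    induction k with
    | zero => simpa using hA
    | succ k ih =>
      rw [eq_top_iff, ← hA]
      refine sup_le le_sup_left ?_
      rw [LieSubmodule.lieIdeal_oper_eq_linear_span', Submodule.span_le]
      rintro _ ⟨u, -, v, -, rfl⟩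
      have hu : u ∈ A.toSubmodule ⊔ (LieModule.lowerCentralSeries ℂ N N (k + 1)).toSubmodule := by
        rw [ih]; trivial
      have hv : v ∈ A.toSubmodule ⊔ (LieModule.lowerCentralSeries ℂ N N (k + 1)).toSubmodule := by
        rw [ih]; trivial
      obtain ⟨a, ha, c, hc, rfl⟩ := Submodule.mem_sup.1 hu
      obtain ⟨b, hb, d, hd, rfl⟩ := Submodule.mem_sup.1 hv
      have h1 : ∀ z w : N, w ∈ LieModule.lowerCentralSeries ℂ N N (k + 1) →
          ⁅z, w⁆ ∈ LieModule.lowerCentralSeries ℂ N N (k + 1 + 1) := fun z w hw => by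
        rw [LieModule.lowerCentralSeries_succ]
        exact LieSubmodule.lie_mem_lie trivial hw
      have h2 : ⁅a + c, b + d⁆ = ⁅a, b⁆ + (⁅a, d⁆ - ⁅b + d, c⁆) := by
        rw [add_lie, lie_add, ← lie_skew c (b + d)]; abel
      rw [h2]
      refine Submodule.add_mem_sup (A.lie_mem ha hb) (Submodule.sub_mem _ ?_ ?_)
      · exact h1 a d hd
      · exact h1 (b + d) c hc
  obtain ⟨k, hk⟩ := (LieModule.isNilpotent_iff ℂ N N).1 hN
  have h0 : LieModule.lowerCentralSeries ℂ N N (k + 1) = ⊥ := by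
    rw [eq_bot_iff, ← hk]
    exact LieModule.antitone_lowerCentralSeries ℂ N N (Nat.le_succ k)
  have := key k
  rw [h0, LieSubmodule.bot_toSubmodule, sup_bot_eq] at this
  change x ∈ A.toSubmodule
  rw [this]; trivial

variable {T : LieSubalgebra ℂ (LieDerivation ℂ N N)}

theorem IsMaxRank.isTorus (hT : IsMaxRank T) : IsTorus T := hT.maximalTorus.prop

theorem IsMaxRank.exists_smul_eq (hT : IsMaxRank T) {α : Module.Dual ℂ T} {x y : N}
    (hx : x ∈ rootSpace T α) (h0 : x ≠ 0) (hy : y ∈ rootSpace T α) : ∃ c : ℂ, y = c • x := by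
  have h1 := hT.finrank_rootSpace α (mem_W_of_ne_zero hx h0)
  obtain ⟨c, hc⟩ := (finrank_eq_one_iff_of_nonzero' (⟨x, hx⟩ : rootSpace T α)
    (fun h => h0 (congrArg Subtype.val h))).1 h1 ⟨y, hy⟩
  exact ⟨c, (congrArg Subtype.val hc).symm⟩

theorem IsMaxRank.lie_eq_zero (hT : IsMaxRank T) {α : Module.Dual ℂ T} {x y : N}
    (hx : x ∈ rootSpace T α) (hy : y ∈ rootSpace T α) : ⁅x, y⁆ = 0 := by
  by_cases h0 : x = 0
  · simp [h0]
  · obtain ⟨c, rfl⟩ := hT.exists_smul_eq hx h0 hy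
    simp

theorem IsMaxRank.lie_ne_zero (hT : IsMaxRank T) {α β : Module.Dual ℂ T} (hαβ : α ≠ β)
    (hW : α + β ∈ W T) {x y : N} (hx : x ∈ rootSpace T α) (hx0 : x ≠ 0)
    (hy : y ∈ rootSpace T β) (hy0 : y ≠ 0) : ⁅x, y⁆ ≠ 0 := by
  intro h
  have := hT.bracket_eq α (mem_W_of_ne_zero hx hx0) β (mem_W_of_ne_zero hy hy0) hαβ hW
  refine hW ?_
  rw [← this, Submodule.span_eq_bot]
  rintro _ ⟨x', hx', y', hy', rfl⟩
  obtain ⟨c, rfl⟩ := hT.exists_smul_eq hx hx0 hx'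
  obtain ⟨d, rfl⟩ := hT.exists_smul_eq hy hy0 hy'
  simp [h]

theorem IsMaxRank.eq_zero_of_mem_derivedIdeal (hT : IsMaxRank T) {α : Module.Dual ℂ T}
    (hα : α ∈ primitive T) {x : N} (hx : x ∈ rootSpace T α) (hD : x ∈ derivedIdeal N) : x = 0 := by
  by_contra h0
  refine hα.2 fun y hy => ?_
  obtain ⟨c, rfl⟩ := hT.exists_smul_eq hx h0 hy
  exact (derivedIdeal N).smul_mem c hD

variable [FiniteDimensional ℂ N]

/-- The primitive weight spaces generate `N`, in the form of an induction principle: a submodule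
that contains them and is stable under bracketing with them is everything. -/
theorem IsMaxRank.eq_top_of_primitive (hT : IsMaxRank T) {U : Submodule ℂ N}
    (h1 : ∀ α ∈ primitive T, rootSpace T α ≤ U)
    (h2 : ∀ α ∈ primitive T, ∀ x ∈ rootSpace T α, ∀ y ∈ U, ⁅x, y⁆ ∈ U) : U = ⊤ := by
  let A : LieSubalgebra ℂ N :=
    { carrier := {x | x ∈ U ∧ ∀ u ∈ U, ⁅x, u⁆ ∈ U}
      add_mem' := fun {x y} hx hy => ⟨U.add_mem hx.1 hy.1, fun u hu => by
        rw [add_lie]; exact U.add_mem (hx.2 u hu) (hy.2 u hu)⟩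
      zero_mem' := ⟨U.zero_mem, fun u _ => by simp⟩
      smul_mem' := fun c x hx => ⟨U.smul_mem c hx.1, fun u hu => by
        rw [smul_lie]; exact U.smul_mem c (hx.2 u hu)⟩
      lie_mem' := fun {x y} hx hy => ⟨hx.2 y hy.1, fun u hu => by
        rw [lie_lie]
        exact U.sub_mem (hx.2 _ (hy.2 u hu)) (hy.2 _ (hx.2 u hu))⟩ }
  have hA : A.toSubmodule ⊔ (derivedIdeal N).toSubmodule = ⊤ := by
    refine eq_top_of_rootSpace_le hT.isTorus fun α hα => ?_
    by_cases hp : α ∈ primitive T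
    · exact le_sup_of_le_left fun x hx => ⟨h1 α hp hx, fun u hu => h2 α hp x hx u hu⟩
    · refine le_sup_of_le_right ?_
      by_contra h
      exact hp ⟨hα, h⟩
  exact eq_top_iff.2 fun x _ => (mem_of_sup_derivedIdeal_eq_top hT.nilpotent A hA x).1

/-- A derivation in `T` is determined by its eigenvalues on the generators of `N`. -/
theorem IsMaxRank.ext_torus (hT : IsMaxRank T) {s t : T}
    (h : ∀ α ∈ primitive T, α s = α t) : s = t := by
  let U : Submodule ℂ N := LinearMap.ker
    (((s : LieDerivation ℂ N N) : N →ₗ[ℂ] N) - ((t : LieDerivation ℂ N N) : N →ₗ[ℂ] N))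
  have hU : ∀ x, x ∈ U ↔ (s : LieDerivation ℂ N N) x = (t : LieDerivation ℂ N N) x := fun x => by
    simp [U, sub_eq_zero]
  have : U = ⊤ := by
    refine hT.eq_top_of_primitive (fun α hα x hx => ?_) (fun α hα x hx y hy => ?_)
    · rw [hU, hx s, hx t, h α hα]
    · rw [hU] at hy ⊢
      rw [LieDerivation.apply_lie_eq_add, LieDerivation.apply_lie_eq_add, hx s, hx t, h α hα, hy]
  refine Subtype.ext (LieDerivation.ext fun x => (hU x).1 ?_)
  rw [this]; trivial

/-- The primitive weights form a basis of the dual of the torus; here, they can take arbitrary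
values at an element of the torus. They separate the elements of `T`, and there are at most
`dim (N / N²) = dim T` of them. -/
theorem IsMaxRank.exists_torus_eq (hT : IsMaxRank T) (c : Module.Dual ℂ T → ℂ) :
    ∃ t : T, ∀ α ∈ primitive T, α t = c α := by
  have hfin : (primitive T).Finite := (finite_W hT.isTorus).subset fun α h => h.1
  have : Fintype (primitive T) := hfin.fintype
  choose e he h0 using fun α : primitive T => exists_mem_rootSpace_ne_zero α.2.1
  choose ξ hξ hξ0 using fun α : primitive T => exists_coord hT.isTorus (he α) (h0 α)
  let ev : T →ₗ[ℂ] (primitive T → ℂ) := LinearMap.pi fun α => (α : Module.Dual ℂ T)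
  have hev : Function.Injective ev := fun s t h =>
    hT.ext_torus fun α hα => congrFun h ⟨α, hα⟩
  have hlie : ∀ (α : primitive T) (x y : N), ξ α ⁅x, y⁆ = 0 := by
    intro α
    let U : Submodule ℂ N := LinearMap.ker
      ((LieModule.toEnd ℂ N N : N →ₗ[ℂ] Module.End ℂ N).compr₂ (ξ α))
    have hU : ∀ x, x ∈ U ↔ ∀ y, ξ α ⁅x, y⁆ = 0 := fun x => by
      simp [U, LinearMap.ext_iff]
    have h1 : U = ⊤ := by
      refine eq_top_of_rootSpace_le hT.isTorus fun β hβ x hx => ?_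
      rw [hU]
      let V : Submodule ℂ N := LinearMap.ker ((ξ α).comp (LieModule.toEnd ℂ N N x))
      have hV : V = ⊤ := by
        refine eq_top_of_rootSpace_le hT.isTorus fun γ hγ y hy => ?_
        change ξ α ⁅x, y⁆ = 0
        have hm := lie_mem_rootSpace hx hy
        by_cases hs : β + γ = α
        · rw [hs] at hm
          rw [hT.eq_zero_of_mem_derivedIdeal α.2 hm (LieSubmodule.lie_mem_lie trivial trivial),
            map_zero]
        · exact hξ0 α _ hs _ hm
      intro y
      have : y ∈ V := by rw [hV]; trivial
      exact this
    intro x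
    rw [← hU, h1]; trivial
  have hD : (derivedIdeal N).toSubmodule ≤ LinearMap.ker (LinearMap.pi ξ) := by
    rw [LieSubmodule.lieIdeal_oper_eq_linear_span', Submodule.span_le]
    rintro _ ⟨u, -, v, -, rfl⟩
    exact funext fun α => hlie α u v
  let q := Submodule.liftQ _ _ hD
  have hq : Function.Surjective q := by
    classical
    intro g
    refine ⟨Submodule.Quotient.mk (∑ α, g α • e α), funext fun β => ?_⟩
    change ξ β (∑ α, g α • e α) = g β
    rw [map_sum, Finset.sum_eq_single β]
    · simp [hξ]
    · intro α _ hα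
      rw [map_smul, hξ0 β α (fun h => hα (Subtype.ext h)) _ (he α), smul_zero]
    · simp
  have hle : Module.finrank ℂ (primitive T → ℂ) ≤ Module.finrank ℂ T := by
    rw [hT.finrank_eq]
    exact LinearMap.finrank_le_finrank_of_surjective hq
  have hfd : FiniteDimensional ℂ T := FiniteDimensional.of_injective ev hev
  have hsurj : Function.Surjective ev := by
    refine (LinearMap.injective_iff_surjective_of_finrank_eq_finrank ?_).1 hev
    exact le_antisymm (LinearMap.finrank_le_finrank_of_injective hev) hle
  obtain ⟨t, ht⟩ := hsurj fun α => c α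
  exact ⟨t, fun α hα => congrFun ht ⟨α, hα⟩⟩

theorem IsMaxRank.finiteDimensional_torus (hT : IsMaxRank T) : FiniteDimensional ℂ T := by
  have hfin : (primitive T).Finite := (finite_W hT.isTorus).subset fun α h => h.1
  have : Fintype (primitive T) := hfin.fintype
  exact FiniteDimensional.of_injective
    (LinearMap.pi fun α : primitive T => (α : Module.Dual ℂ T))
    fun s t h => hT.ext_torus fun α hα => congrFun h ⟨α, hα⟩

/-- Every weight is a sum of primitive weights: an additively closed property of the values of the
primitive weights at `t` holds for all weights. -/
theorem IsMaxRank.weight_induction (hT : IsMaxRank T) (t : T) (P : ℂ → Prop)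
    (h1 : ∀ α ∈ primitive T, P (α t)) (h2 : ∀ a b, P a → P b → P (a + b)) :
    ∀ l ∈ W T, P (l t) := by
  refine fun l hl => W_subset_of_iSup_eq_top hT.isTorus (S := {l | P (l t)}) ?_ hl
  refine hT.eq_top_of_primitive (fun α hα => le_iSup₂_of_le α (h1 α hα) le_rfl)
    (fun α hα x hx y hy => ?_)
  have : (⨆ l ∈ {l : Module.Dual ℂ T | P (l t)}, rootSpace T l) ≤
      (⨆ l ∈ {l : Module.Dual ℂ T | P (l t)}, rootSpace T l).comap (LieModule.toEnd ℂ N N x) := by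
    refine iSup₂_le fun l hl z hz => ?_
    exact Submodule.mem_iSup_of_mem (α + l) (Submodule.mem_iSup_of_mem (h2 _ _ (h1 α hα) hl)
      (lie_mem_rootSpace hx hz))
  exact this hy

/-- As `[N_α, N_α] = 0`, the case `α = γ` can be excluded here. -/
theorem IsMaxRank.eq_add_of_notMem_primitive (hT : IsMaxRank T) {l : Module.Dual ℂ T}
    (hl : l ∈ W T) (hp : l ∉ primitive T) :
    ∃ α ∈ primitive T, ∃ γ ∈ W T, α ≠ γ ∧ l = α + γ := by
  let S : Set (Module.Dual ℂ T) :=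
    {l | l ∈ primitive T ∨ ∃ α ∈ primitive T, ∃ γ ∈ W T, α ≠ γ ∧ l = α + γ}
  have hS : W T ⊆ S := by
    refine W_subset_of_iSup_eq_top hT.isTorus ?_
    refine hT.eq_top_of_primitive (fun α hα => le_iSup₂_of_le α (Or.inl hα) le_rfl)
      (fun α hα x hx y _ => ?_)
    have : (⨆ l ∈ S, rootSpace T l).comap (LieModule.toEnd ℂ N N x) = ⊤ := by
      refine eq_top_of_rootSpace_le hT.isTorus fun γ hγ z hz => ?_
      change ⁅x, z⁆ ∈ ⨆ l ∈ S, rootSpace T l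
      by_cases hαγ : α = γ
      · subst hαγ
        rw [hT.lie_eq_zero hx hz]; exact Submodule.zero_mem _
      · exact Submodule.mem_iSup_of_mem (α + γ) (Submodule.mem_iSup_of_mem
          (Or.inr ⟨α, hα, γ, hγ, hαγ, rfl⟩) (lie_mem_rootSpace hx hz))
    have hy : y ∈ (⨆ l ∈ S, rootSpace T l).comap (LieModule.toEnd ℂ N N x) := by
      rw [this]; trivial
    exact hy
  exact (hS hl).resolve_left hp

/-- An element of the torus at which every weight takes its height as value. -/
theorem IsMaxRank.exists_height (hT : IsMaxRank T) :
    ∃ t : T, (∀ α ∈ primitive T, α t = 1) ∧ ∀ l ∈ W T, ∃ n : ℕ, l t = n + 1 := by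
  obtain ⟨t, ht⟩ := hT.exists_torus_eq fun _ => 1
  refine ⟨t, ht, hT.weight_induction t (fun z => ∃ n : ℕ, z = n + 1)
    (fun α hα => ⟨0, by simp [ht α hα]⟩) ?_⟩
  rintro _ _ ⟨m, rfl⟩ ⟨n, rfl⟩
  exact ⟨m + n + 1, by push_cast; ring⟩

/-- The coordinate of weights along the primitive weight `α`. -/
theorem IsMaxRank.exists_coroot (hT : IsMaxRank T) {α : Module.Dual ℂ T} (hα : α ∈ primitive T) :
    ∃ t : T, α t = 1 ∧ (∀ β ∈ primitive T, β ≠ α → β t = 0) ∧ ∀ l ∈ W T, ∃ n : ℕ, l t = n := by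
  classical
  obtain ⟨t, ht⟩ := hT.exists_torus_eq fun β => if β = α then 1 else 0
  refine ⟨t, by simp [ht α hα], fun β hβ h => by simp [ht β hβ, h],
    hT.weight_induction t (fun z => ∃ n : ℕ, z = n) (fun β hβ => ?_) ?_⟩
  · rw [ht β hβ]
    split_ifs
    · exact ⟨1, by simp⟩
    · exact ⟨0, by simp⟩
  · rintro _ _ ⟨m, rfl⟩ ⟨n, rfl⟩
    exact ⟨m + n, by push_cast; ring⟩

theorem IsMaxRank.zero_notMem_W (hT : IsMaxRank T) : (0 : Module.Dual ℂ T) ∉ W T := fun h => by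
  obtain ⟨t, -, ht⟩ := hT.exists_height
  obtain ⟨n, hn⟩ := ht 0 h
  rw [LinearMap.zero_apply] at hn
  norm_cast at hn

theorem IsMaxRank.add_ne_zero (hT : IsMaxRank T) {α β : Module.Dual ℂ T} (hα : α ∈ W T)
    (hβ : β ∈ W T) : α + β ≠ 0 := fun h => by
  obtain ⟨t, -, ht⟩ := hT.exists_height
  obtain ⟨m, hm⟩ := ht α hα
  obtain ⟨n, hn⟩ := ht β hβ
  have := LinearMap.congr_fun h t
  rw [LinearMap.add_apply, hm, hn, LinearMap.zero_apply] at this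
  norm_cast at this

theorem IsMaxRank.add_notMem_primitive (hT : IsMaxRank T) {α β : Module.Dual ℂ T} (hα : α ∈ W T)
    (hβ : β ∈ W T) : α + β ∉ primitive T := fun h => by
  obtain ⟨t, ht1, ht⟩ := hT.exists_height
  obtain ⟨m, hm⟩ := ht α hα
  obtain ⟨n, hn⟩ := ht β hβ
  have := ht1 _ h
  rw [LinearMap.add_apply, hm, hn] at this
  norm_cast at this
  omega

/-- As weights have coefficients in `ℕ` with respect to the primitive weights, only `α` and `β` can
be subtracted from `m α + n β`. -/
theorem IsMaxRank.eq_or_eq_of_add_eq (hT : IsMaxRank T) {α β γ δ : Module.Dual ℂ T}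
    (hα : α ∈ primitive T) (hβ : β ∈ primitive T) (hγ : γ ∈ primitive T) (hδ : δ ∈ W T) {m n : ℕ}
    (h : γ + δ = m • α + n • β) : γ = α ∨ γ = β := by
  by_contra! hne
  obtain ⟨t, h1, h2, h3⟩ := hT.exists_coroot hγ
  obtain ⟨k, hk⟩ := h3 δ hδ
  have := LinearMap.congr_fun h t
  simp only [LinearMap.add_apply, LinearMap.smul_apply, h1, hk, h2 α hα hne.1.symm,
    h2 β hβ hne.2.symm, smul_zero, add_zero] at this
  norm_cast at this
  omega

/-- The weight space of `2 α` would be spanned by `[N_α, N_α] = 0`. -/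
theorem IsMaxRank.add_self_notMem_W (hT : IsMaxRank T) {α : Module.Dual ℂ T}
    (hα : α ∈ primitive T) : α + α ∉ W T := fun h => by
  obtain ⟨β, hβ, γ, hγ, hne, heq⟩ := hT.eq_add_of_notMem_primitive h
    (hT.add_notMem_primitive hα.1 hα.1)
  have : β = α := by
    simpa using hT.eq_or_eq_of_add_eq (m := 1) (n := 1) hα hα hβ hγ (by simp [heq])
  subst this
  exact hne (add_left_cancel heq)

end Generators

/-! ### Cocycles with trivial coefficients at a single weight -/

section SingleWeight

variable {N : Type*} [LieRing N] [LieAlgebra ℂ N] {T : LieSubalgebra ℂ (LieDerivation ℂ N N)}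
variable {V : Type*} [AddCommGroup V] [Module ℂ V]

/-- The alternating map `f` satisfies the cocycle identity with trivial coefficients on all triples
of weight vectors of total weight `l`. -/
structure IsCocycleAt (l : Module.Dual ℂ T) (f : N →ₗ[ℂ] N →ₗ[ℂ] V) : Prop where
  self_eq_zero : ∀ x, f x x = 0
  lie_left : ∀ α β γ : Module.Dual ℂ T, α + β + γ = l → ∀ x ∈ rootSpace T α,
    ∀ y ∈ rootSpace T β, ∀ z ∈ rootSpace T γ, f ⁅x, y⁆ z = f x ⁅y, z⁆ - f y ⁅x, z⁆

variable {l : Module.Dual ℂ T} {f : N →ₗ[ℂ] N →ₗ[ℂ] V}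

theorem IsCocycleAt.skew (hf : IsCocycleAt l f) (x y : N) : f x y = -f y x := by
  have := hf.self_eq_zero (x + y)
  simp only [map_add, LinearMap.add_apply, hf.self_eq_zero, zero_add, add_zero] at this
  exact eq_neg_of_add_eq_zero_right this

theorem IsCocycleAt.sub_comp_lie (hf : IsCocycleAt l f) (g : N →ₗ[ℂ] V) :
    IsCocycleAt l (f - (LieModule.toEnd ℂ N N : N →ₗ[ℂ] Module.End ℂ N).compr₂ g) where
  self_eq_zero x := by simp [hf.self_eq_zero]
  lie_left α β γ h x hx y hy z hz := by
    have h1 : g ⁅⁅x, y⁆, z⁆ = g ⁅x, ⁅y, z⁆⁆ - g ⁅y, ⁅x, z⁆⁆ := by rw [lie_lie, map_sub]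
    change f ⁅x, y⁆ z - g ⁅⁅x, y⁆, z⁆ = (f x ⁅y, z⁆ - g ⁅x, ⁅y, z⁆⁆) - (f y ⁅x, z⁆ - g ⁅y, ⁅x, z⁆⁆)
    rw [hf.lie_left α β γ h x hx y hy z hz, h1]
    abel

variable [FiniteDimensional ℂ N]

/-- A cocycle of weight `l` is determined by its values `f(N_α, N_γ)` with `α` primitive, because
the primitive weight vectors generate `N`. -/
theorem IsCocycleAt.eq_zero (hT : IsMaxRank T) (hf : IsCocycleAt l f)
    (h : ∀ α ∈ primitive T, ∀ γ, α + γ = l → ∀ x ∈ rootSpace T α, ∀ y ∈ rootSpace T γ, f x y = 0) :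
    ∀ α β, α + β = l → ∀ x ∈ rootSpace T α, ∀ y ∈ rootSpace T β, f x y = 0 := by
  obtain ⟨t, ht1, ht⟩ := hT.exists_height
  have key : ∀ n : ℕ, ∀ α : Module.Dual ℂ T, α t = n → ∀ β, α + β = l → ∀ x ∈ rootSpace T α,
      ∀ y ∈ rootSpace T β, f x y = 0 := by
    intro n
    induction n using Nat.strong_induction_on with
    | _ n ih =>
      intro α hn β hαβ x hx y hy
      by_cases hp : α ∈ primitive T
      · exact h α hp β hαβ x hx y hy
      by_cases hx0 : x = 0
      · simp [hx0]
      have hα := mem_W_of_ne_zero hx hx0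
      obtain ⟨γ, hγ, δ, hδ, hne, rfl⟩ := hT.eq_add_of_notMem_primitive hα hp
      obtain ⟨u, hu, hu0⟩ := exists_mem_rootSpace_ne_zero hγ.1
      obtain ⟨v, hv, hv0⟩ := exists_mem_rootSpace_ne_zero hδ
      obtain ⟨c, rfl⟩ := hT.exists_smul_eq (lie_mem_rootSpace hu hv)
        (hT.lie_ne_zero hne hα hu hu0 hv hv0) hx
      obtain ⟨m, hm⟩ := ht δ hδ
      have hmn : m + 1 < n := by
        rw [LinearMap.add_apply, ht1 γ hγ, hm] at hn
        norm_cast at hn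
        omega
      rw [map_smul, LinearMap.smul_apply, hf.lie_left γ δ β hαβ u hu v hv y hy,
        h γ hγ (δ + β) (by rw [← add_assoc, hαβ]) u hu _ (lie_mem_rootSpace hv hy),
        ih (m + 1) hmn δ (by rw [hm]; push_cast; rfl) (γ + β) (by rw [← hαβ]; abel) v hv _
          (lie_mem_rootSpace hu hy), sub_zero, smul_zero]
  intro α β hαβ x hx y hy
  by_cases hx0 : x = 0
  · simp [hx0]
  obtain ⟨n, hn⟩ := ht α (mem_W_of_ne_zero hx hx0)
  exact key (n + 1) α (by rw [hn]; push_cast; rfl) β hαβ x hx y hy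

/-- Under the Leger-Luks condition, a cocycle of weight `l` that vanishes on one pair
`N_α × N_γ` with `α` primitive and `α + γ = l` vanishes on all such pairs: the Serre type relation
`[b, [b, a]] = 0` or `[a, [a, b]] = 0` allows to compare `f(b, [a, m])` with `f(a, [b, m])`. -/
theorem IsCocycleAt.eq_zero_of_legerLuks (hT : IsMaxRank T) (hf : IsCocycleAt l f) (hl : l ∈ W T)
    (hLL : LegerLuks T l) {α γ : Module.Dual ℂ T} (hα : α ∈ primitive T) (hγ : γ ∈ W T)
    (hαγ : α + γ = l) (h0 : ∀ x ∈ rootSpace T α, ∀ y ∈ rootSpace T γ, f x y = 0) :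
    ∀ β ∈ primitive T, ∀ δ, β + δ = l → ∀ x ∈ rootSpace T β, ∀ y ∈ rootSpace T δ, f x y = 0 := by
  intro β hβ δ hβδ b hb y hy
  by_cases hne : α = β
  · subst hne
    have : δ = γ := add_left_cancel (hβδ.trans hαγ.symm)
    subst this
    exact h0 b hb y hy
  by_cases hb0 : b = 0
  · simp [hb0]
  by_cases hy0 : y = 0
  · simp [hy0]
  have hδ := mem_W_of_ne_zero hy hy0
  obtain ⟨μ, hμ, rfl, rfl, hcase⟩ := hLL α hα β hβ hne γ hγ δ hδ hαγ.symm hβδ.symm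
  have hαμ : α ≠ μ := by
    rintro rfl
    exact hT.add_self_notMem_W hα hδ
  have hβμ : β ≠ μ := by
    rintro rfl
    exact hT.add_self_notMem_W hβ hγ
  obtain ⟨a, ha, ha0⟩ := exists_mem_rootSpace_ne_zero hα.1
  -- It suffices to treat `y = [a, m]`, for one nonzero `m ∈ N_μ` of our choice.
  suffices H : ∃ m ∈ rootSpace T μ, m ≠ 0 ∧ f b ⁅a, m⁆ = 0 by
    obtain ⟨m, hm, hm0, hfm⟩ := H
    obtain ⟨c, rfl⟩ := hT.exists_smul_eq (lie_mem_rootSpace ha hm)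
      (hT.lie_ne_zero hαμ hδ ha ha0 hm hm0) hy
    rw [map_smul, hfm, smul_zero]
  have hred : ∀ m ∈ rootSpace T μ, f ⁅b, a⁆ m = f b ⁅a, m⁆ := fun m hm => by
    rw [hf.lie_left β α μ (by rw [← hβδ]; abel) b hb a ha m hm,
      h0 a ha _ (lie_mem_rootSpace hb hm), sub_zero]
  have hba := lie_mem_rootSpace hb ha
  rcases hcase with hW | ⟨-, hW, ν, hν, rfl⟩ | ⟨-, hW, ν, hν, rfl⟩
  · obtain ⟨m, hm, hm0⟩ := exists_mem_rootSpace_ne_zero hμ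
    refine ⟨m, hm, hm0, ?_⟩
    rw [← hred m hm, eq_zero_of_notMem_W (x := ⁅b, a⁆) hW (by rwa [add_comm α β]), map_zero,
      LinearMap.zero_apply]
  · obtain ⟨n, hn, hn0⟩ := exists_mem_rootSpace_ne_zero hν
    have hβν : β ≠ ν := by
      rintro rfl
      exact hT.add_self_notMem_W hβ hμ
    have hm := lie_mem_rootSpace hb hn
    have hm0 := hT.lie_ne_zero hβν hμ hb hb0 hn hn0
    refine ⟨⁅b, n⁆, hm, hm0, ?_⟩
    have hd := lie_mem_rootSpace ha hm
    have hd0 := hT.lie_ne_zero hαμ hδ ha ha0 hm hm0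
    have hserre : ⁅b, ⁅b, a⁆⁆ = 0 := by
      refine eq_zero_of_notMem_W hW ?_
      have := lie_mem_rootSpace hb hba
      rwa [show β + (β + α) = α + (2 : ℂ) • β by rw [two_smul]; abel] at this
    -- `[b, [a, n]]` is a multiple `c` of the generator `[a, [b, n]]` of its weight space.
    obtain ⟨c, hc⟩ := hT.exists_smul_eq hd hd0 (y := ⁅b, ⁅a, n⁆⁆) (by
      have := lie_mem_rootSpace hb (lie_mem_rootSpace ha hn)
      rwa [show β + (α + ν) = α + (β + ν) by abel] at this)
    have hban : ⁅⁅b, a⁆, n⁆ = (c - 1) • ⁅a, ⁅b, n⁆⁆ := by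
      rw [lie_lie, hc, sub_smul, one_smul]
    -- In `N`, the relation `[b, [b, a]] = 0` excludes `c = 2`.
    have hc2 : c - 2 ≠ 0 := by
      intro hc2
      refine hT.lie_ne_zero (fun h => ?_) (hαγ.symm ▸ hl) ha ha0 (lie_mem_rootSpace hb hm)
        (hT.lie_ne_zero hβμ hγ hb hb0 hm hm0) ?_
      · rw [← h] at hαγ
        exact hT.add_self_notMem_W hα (hαγ.symm ▸ hl)
      · have h1 : ⁅b, ⁅⁅b, a⁆, n⁆⁆ = ⁅⁅b, a⁆, ⁅b, n⁆⁆ := by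
          rw [leibniz_lie b ⁅b, a⁆ n, hserre, zero_lie, zero_add]
        rw [hban, lie_smul, lie_lie] at h1
        have h2 : ⁅a, ⁅b, ⁅b, n⁆⁆⁆ = -((c - 2) • ⁅b, ⁅a, ⁅b, n⁆⁆⁆) := by
          linear_combination (norm := module) h1
        rw [h2, hc2, zero_smul, neg_zero]
    -- For `f`, the same relation gives `(c - 2) f(b, [a, [b, n]]) = 0`.
    have h3 := hf.lie_left β (β + α) ν (by rw [← hβδ]; abel) b hb _ hba n hn
    rw [hserre, map_zero, LinearMap.zero_apply, hred _ hm, hban, map_smul] at h3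
    have h4 : (c - 2) • f b ⁅a, ⁅b, n⁆⁆ = 0 := by
      linear_combination (norm := module) -h3
    exact (smul_eq_zero.1 h4).resolve_left hc2
  · obtain ⟨n, hn, hn0⟩ := exists_mem_rootSpace_ne_zero hν
    have hαν : α ≠ ν := by
      rintro rfl
      exact hT.add_self_notMem_W hα hμ
    have hm := lie_mem_rootSpace ha hn
    refine ⟨⁅a, n⁆, hm, hT.lie_ne_zero hαν hμ ha ha0 hn hn0, ?_⟩
    have hserre : ⁅a, ⁅b, a⁆⁆ = 0 := by
      refine eq_zero_of_notMem_W hW ?_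
      have := lie_mem_rootSpace ha hba
      rwa [show α + (β + α) = (2 : ℂ) • α + β by rw [two_smul]; abel] at this
    have h3 := hf.lie_left α (β + α) ν (by rw [← hβδ]; abel) a ha _ hba n hn
    have h5 := lie_mem_rootSpace hba hn
    rw [add_assoc] at h5
    rw [hserre, map_zero, LinearMap.zero_apply, h0 a ha _ h5, zero_sub, hred _ hm] at h3
    exact neg_eq_zero.1 h3.symm

/-- At a non-primitive weight `l` satisfying one of the three conditions, there is a single pair
`N_α × N_γ` with `α` primitive and `α + γ = l` that detects whether a cocycle vanishes. -/
theorem exists_detecting_pair (hT : IsMaxRank T) (hl : l ∈ W T) (hp : l ∉ primitive T)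
    (h : LegerLuks T l ∨ UniqueDecomposition T l ∨ ShortWeight T l) :
    ∃ α ∈ primitive T, ∃ γ ∈ W T, α ≠ γ ∧ α + γ = l ∧ ∀ f : N →ₗ[ℂ] N →ₗ[ℂ] V, IsCocycleAt l f →
      (∀ x ∈ rootSpace T α, ∀ y ∈ rootSpace T γ, f x y = 0) →
      ∀ β ∈ primitive T, ∀ δ, β + δ = l → ∀ x ∈ rootSpace T β, ∀ y ∈ rootSpace T δ, f x y = 0 := by
  obtain ⟨α, hα, γ, hγ, hne, hsum⟩ := hT.eq_add_of_notMem_primitive hl hp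
  rcases h with h | ⟨α', hα', ⟨μ, hμ, h⟩, huniq⟩ | ⟨α', hα', β', hβ', hne', h | h⟩
  · exact ⟨α, hα, γ, hγ, hne, hsum.symm, fun f hf h0 =>
      hf.eq_zero_of_legerLuks hT hl h hα hγ hsum.symm h0⟩
  · refine ⟨α', hα', μ, hμ, ?_, h.symm, fun f hf h0 β hβ δ hδ x hx y hy => ?_⟩
    · rintro rfl
      exact hT.add_self_notMem_W hα' (h ▸ hl)
    · by_cases hβα : β = α'
      · subst hβα
        have : δ = μ := add_left_cancel (hδ.trans h)
        subst this
        exact h0 x hx y hy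
      · rw [eq_zero_of_notMem_W (x := y) (fun hW => huniq β hβ hβα ?_) hy, map_zero]
        rwa [← hδ, add_sub_cancel_left]
  · refine ⟨α', hα', β', hβ'.1, hne', h.symm, fun f hf h0 β hβ δ hδ x hx y hy => ?_⟩
    by_cases hδW : δ ∈ W T
    · rcases hT.eq_or_eq_of_add_eq (m := 1) (n := 1) hα' hβ' hβ hδW (by simp [hδ, h]) with
        rfl | rfl
      · have : δ = β' := add_left_cancel (hδ.trans h)
        subst this
        exact h0 x hx y hy
      · have : δ = α' := add_left_cancel (hδ.trans (h.trans (add_comm _ _)))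
        subst this
        rw [hf.skew, h0 y hy x hx, neg_zero]
    · rw [eq_zero_of_notMem_W hδW hy, map_zero]
  · -- Only `α'` can be subtracted from `2 α' + β'`, as `2 α'` is not a weight.
    have key : ∀ β ∈ primitive T, ∀ δ ∈ W T, β + δ = l → β = α' ∧ δ = α' + β' := by
      intro β hβ δ hδW hδ
      rcases hT.eq_or_eq_of_add_eq (m := 2) (n := 1) hα' hβ' hβ hδW
        (by rw [hδ, h, two_smul, one_smul, add_assoc]) with rfl | rfl
      · exact ⟨rfl, add_left_cancel (hδ.trans h)⟩
      · have : δ = α' + α' := add_left_cancel (hδ.trans (h.trans (by abel)))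
        exact absurd (this ▸ hδW) (hT.add_self_notMem_W hα')
    obtain ⟨rfl, rfl⟩ := key α hα γ hγ hsum.symm
    refine ⟨α, hα, α + β', hγ, hne, hsum.symm, fun f hf h0 β hβ δ hδ x hx y hy => ?_⟩
    by_cases hδW : δ ∈ W T
    · obtain ⟨rfl, rfl⟩ := key β hβ δ hδW hδ
      exact h0 x hx y hy
    · rw [eq_zero_of_notMem_W hδW hy, map_zero]

/-- A cocycle of weight `l` with trivial coefficients is of the form `(x, y) ↦ g [x, y]`, with `g`
of weight `l`. -/
theorem IsCocycleAt.exists_eq_comp_lie (hT : IsMaxRank T) (hf : IsCocycleAt l f) (hl : l ∈ W T)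
    (hp : l ∉ primitive T) (h : LegerLuks T l ∨ UniqueDecomposition T l ∨ ShortWeight T l)
    (Q : Submodule ℂ V)
    (hQ : ∀ α β, α + β = l → ∀ x ∈ rootSpace T α, ∀ y ∈ rootSpace T β, f x y ∈ Q) :
    ∃ g : N →ₗ[ℂ] V, (∀ x, g x ∈ Q) ∧ (∀ β ≠ l, ∀ x ∈ rootSpace T β, g x = 0) ∧
      ∀ α β, α + β = l → ∀ x ∈ rootSpace T α, ∀ y ∈ rootSpace T β, f x y = g ⁅x, y⁆ := by
  obtain ⟨α, hα, γ, hγ, hne, hsum, hdet⟩ := exists_detecting_pair (V := V) hT hl hp h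
  obtain ⟨p, hp, hp0⟩ := exists_mem_rootSpace_ne_zero hα.1
  obtain ⟨q, hq, hq0⟩ := exists_mem_rootSpace_ne_zero hγ
  obtain ⟨ξ, h1, h2⟩ := exists_coord hT.isTorus (lie_mem_rootSpace hp hq)
    (hT.lie_ne_zero hne (hsum.symm ▸ hl) hp hp0 hq hq0)
  rw [hsum] at h2
  have hf' := hf.sub_comp_lie (ξ.smulRight (f p q))
  refine ⟨ξ.smulRight (f p q), fun x => Q.smul_mem _ (hQ α γ hsum p hp q hq),
    fun β hβ x hx => ?_, fun β δ hβδ x hx y hy => ?_⟩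
  · rw [LinearMap.smulRight_apply, h2 β hβ x hx, zero_smul]
  · refine sub_eq_zero.1 (hf'.eq_zero hT (hdet _ hf' fun x hx y hy => ?_) β δ hβδ x hx y hy)
    obtain ⟨c, rfl⟩ := hT.exists_smul_eq hp hp0 hx
    obtain ⟨d, rfl⟩ := hT.exists_smul_eq hq hq0 hy
    change f (c • p) (d • q) - ξ ⁅c • p, d • q⁆ • f p q = 0
    simp only [map_smul, LinearMap.smul_apply, smul_lie, lie_smul, h1, smul_eq_mul]
    module

end SingleWeight

/-! ### Invariant cocycles are coboundaries of equivariant maps -/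

section InvariantCocycles

variable {N : Type*} [LieRing N] [LieAlgebra ℂ N] {T : LieSubalgebra ℂ (LieDerivation ℂ N N)}
variable {M : Type*} [AddCommGroup M] [Module ℂ M]
variable [LieRingModule (SolvExt T) M] [LieModule ℂ (SolvExt T) M]

variable (T) in
/-- A `T`-invariant 2-cocycle of `N` with values in the `N ⋊ T`-module `M`, as a bilinear map. -/
structure IsInvariantCocycle (f : N →ₗ[ℂ] N →ₗ[ℂ] M) : Prop where
  self_eq_zero : ∀ x, f x x = 0
  invariant : ∀ (t : T) (x y : N), ⁅inT T t, f x y⁆ =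
    f ((t : LieDerivation ℂ N N) x) y + f x ((t : LieDerivation ℂ N N) y)
  cocycle : ∀ x y z : N, ⁅inN T x, f y z⁆ - ⁅inN T y, f x z⁆ + ⁅inN T z, f x y⁆
    - f ⁅x, y⁆ z + f ⁅x, z⁆ y - f ⁅y, z⁆ x = 0

variable (T) in
/-- A linear map `N → M` commuting with the actions of `T`. -/
def IsEquivariant (g : N →ₗ[ℂ] M) : Prop :=
  ∀ (t : T) (x : N), ⁅inT T t, g x⁆ = g ((t : LieDerivation ℂ N N) x)

variable (T) in
/-- The coboundary `(x, y) ↦ x g(y) - y g(x) - g [x, y]` of a linear map `g : N → M`. -/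
def coboundary (g : N →ₗ[ℂ] M) : N →ₗ[ℂ] N →ₗ[ℂ] M :=
  LinearMap.mk₂ ℂ (fun x y => ⁅inN T x, g y⁆ - ⁅inN T y, g x⁆ - g ⁅x, y⁆)
    (fun x x' y => by simp only [map_add, add_lie, lie_add]; abel)
    (fun c x y => by simp only [map_smul, smul_lie, lie_smul, smul_sub])
    (fun x y y' => by simp only [map_add, add_lie, lie_add]; abel)
    (fun c x y => by simp only [map_smul, smul_lie, lie_smul, smul_sub])

theorem coboundary_apply (g : N →ₗ[ℂ] M) (x y : N) :
    coboundary T g x y = ⁅inN T x, g y⁆ - ⁅inN T y, g x⁆ - g ⁅x, y⁆ := rfl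

theorem coboundary_add (g h : N →ₗ[ℂ] M) :
    coboundary T (g + h) = coboundary T g + coboundary T h := by
  refine LinearMap.ext₂ fun x y => ?_
  simp only [coboundary_apply, LinearMap.add_apply, lie_add]
  abel

theorem IsInvariantCocycle.sub_coboundary {f : N →ₗ[ℂ] N →ₗ[ℂ] M} (hf : IsInvariantCocycle T f)
    {g : N →ₗ[ℂ] M} (hg : IsEquivariant T g) : IsInvariantCocycle T (f - coboundary T g) where
  self_eq_zero x := by simp [coboundary_apply, hf.self_eq_zero]
  invariant t x y := by
    simp only [LinearMap.sub_apply, coboundary_apply, lie_sub, hf.invariant, inT_lie_inN, hg t,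
      LieDerivation.apply_lie_eq_add, map_add]
    abel
  cocycle x y z := by
    have h := hf.cocycle x y z
    have h1 : ∀ (x y : N) (m : M), ⁅inN T ⁅x, y⁆, m⁆ = ⁅inN T x, ⁅inN T y, m⁆⁆ -
        ⁅inN T y, ⁅inN T x, m⁆⁆ := fun x y m => by rw [LieHom.map_lie, lie_lie]
    have h2 : g ⁅⁅x, y⁆, z⁆ - g ⁅⁅x, z⁆, y⁆ + g ⁅⁅y, z⁆, x⁆ = 0 := by
      rw [← map_sub, ← map_add, ← lie_skew ⁅x, z⁆ y, ← lie_skew ⁅y, z⁆ x, lie_lie x y z,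
        sub_neg_eq_add, sub_add_cancel, add_neg_cancel, map_zero]
    simp only [LinearMap.sub_apply, coboundary_apply, lie_sub, h1]
    linear_combination (norm := module) h - h2

theorem IsInvariantCocycle.mem_weightSpace {f : N →ₗ[ℂ] N →ₗ[ℂ] M} (hf : IsInvariantCocycle T f)
    {α β : Module.Dual ℂ T} {x y : N} (hx : x ∈ rootSpace T α) (hy : y ∈ rootSpace T β) :
    f x y ∈ weightSpace T M (α + β) := fun t => by
  rw [hf.invariant, hx t, hy t, map_smul, map_smul, LinearMap.smul_apply, ← add_smul,
    LinearMap.add_apply]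

/-- `f` vanishes on the pairs of weight vectors of total height less than `n`, where the height of a
weight is its value at `t`. -/
def VanishesBelow (t : T) (n : ℕ) (f : N →ₗ[ℂ] N →ₗ[ℂ] M) : Prop :=
  ∀ (α β : Module.Dual ℂ T), ∀ k < n, (α + β) t = (k : ℕ) → ∀ x ∈ rootSpace T α,
    ∀ y ∈ rootSpace T β, f x y = 0

/-- As `N` raises heights in `M`, the lowest components of an invariant cocycle are cocycles with
trivial coefficients. -/
theorem IsInvariantCocycle.isCocycleAt {f : N →ₗ[ℂ] N →ₗ[ℂ] M} (hf : IsInvariantCocycle T f) {t : T}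
    (ht : ∀ l ∈ W T, ∃ n : ℕ, l t = n + 1) {n : ℕ} (hn : VanishesBelow t n f)
    {l : Module.Dual ℂ T} (hl : l t = n) : IsCocycleAt l f where
  self_eq_zero := hf.self_eq_zero
  lie_left α β γ h x hx y hy z hz := by
    have low : ∀ α β γ : Module.Dual ℂ T, α + β + γ = l → ∀ x ∈ rootSpace T α,
        ∀ y ∈ rootSpace T β, ∀ z ∈ rootSpace T γ, ⁅inN T x, f y z⁆ = 0 := by
      intro α β γ h x hx y hy z hz
      by_cases hx0 : x = 0
      · rw [hx0, map_zero, zero_lie]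
      by_cases hy0 : y = 0
      · rw [hy0, map_zero, LinearMap.zero_apply, lie_zero]
      by_cases hz0 : z = 0
      · rw [hz0, map_zero, lie_zero]
      obtain ⟨a, ha⟩ := ht α (mem_W_of_ne_zero hx hx0)
      obtain ⟨b, hb⟩ := ht β (mem_W_of_ne_zero hy hy0)
      obtain ⟨c, hc⟩ := ht γ (mem_W_of_ne_zero hz hz0)
      rw [← h, LinearMap.add_apply, LinearMap.add_apply, ha, hb, hc] at hl
      norm_cast at hl
      rw [hn β γ (b + 1 + (c + 1)) (by omega) (by rw [LinearMap.add_apply, hb, hc]; push_cast; rfl)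
        y hy z hz, lie_zero]
    have skew : ∀ x y, f x y = -f y x := fun x y => by
      have := hf.self_eq_zero (x + y)
      simp only [map_add, LinearMap.add_apply, hf.self_eq_zero, zero_add, add_zero] at this
      exact eq_neg_of_add_eq_zero_right this
    have := hf.cocycle x y z
    rw [low α β γ h x hx y hy z hz, low β α γ (by rw [← h]; abel) y hy x hx z hz,
      low γ α β (by rw [← h]; abel) z hz x hx y hy, skew ⁅x, z⁆ y, skew ⁅y, z⁆ x] at this
    linear_combination (norm := module) -this

variable [FiniteDimensional ℂ N]

theorem ext_rootSpace (hT : IsTorus T) {V : Type*} [AddCommGroup V] [Module ℂ V]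
    {f g : N →ₗ[ℂ] V} (h : ∀ α ∈ W T, ∀ x ∈ rootSpace T α, f x = g x) : f = g := by
  have : LinearMap.eqLocus f g = ⊤ := eq_top_of_rootSpace_le hT h
  exact LinearMap.eqLocus_eq_top.1 this

theorem isEquivariant_of_weight (hT : IsTorus T) {l : Module.Dual ℂ T} {g : N →ₗ[ℂ] M}
    (h1 : ∀ x, g x ∈ weightSpace T M l) (h2 : ∀ β ≠ l, ∀ x ∈ rootSpace T β, g x = 0) :
    IsEquivariant T g := by
  intro t
  suffices h : (LieModule.toEnd ℂ (SolvExt T) M (inT T t)).comp g =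
      g.comp ((t : LieDerivation ℂ N N) : N →ₗ[ℂ] N) from LinearMap.congr_fun h
  refine ext_rootSpace hT fun β _ x hx => ?_
  change ⁅inT T t, g x⁆ = g ((t : LieDerivation ℂ N N) x)
  rw [hx t, map_smul]
  by_cases hβ : β = l
  · rw [h1 x t, hβ]
  · rw [h2 β hβ x hx, lie_zero, smul_zero]

/-- The values of an invariant cocycle have weights in `W`, even if the weight `0` is allowed in
`M`, as a sum of two weights of `N` is not `0`. -/
theorem IsInvariantCocycle.eq_zero_of_notMem_W (hT : IsMaxRank T)
    (hM : ∀ χ, weightSpace T M χ ≠ ⊥ → χ ∈ W T ∨ χ = 0) {f : N →ₗ[ℂ] N →ₗ[ℂ] M}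
    (hf : IsInvariantCocycle T f) {α β : Module.Dual ℂ T} {x y : N} (hx : x ∈ rootSpace T α)
    (hy : y ∈ rootSpace T β) (h : α + β ∉ W T) : f x y = 0 := by
  by_contra h0
  have hx0 : x ≠ 0 := by rintro rfl; simp at h0
  have hy0 : y ≠ 0 := by rintro rfl; simp at h0
  rcases hM (α + β) ((Submodule.ne_bot_iff _).2 ⟨_, hf.mem_weightSpace hx hy, h0⟩) with h1 | h1
  · exact h h1
  · exact hT.add_ne_zero (mem_W_of_ne_zero hx hx0) (mem_W_of_ne_zero hy hy0) h1

/-- The components of total height `n` are removed by a sum of maps, one for each weight of height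
`n`. This does not affect the components of smaller height. -/
theorem IsInvariantCocycle.exists_vanishesBelow_succ (hT : IsMaxRank T)
    (hW : ∀ l ∈ W T, LegerLuks T l ∨ UniqueDecomposition T l ∨ ShortWeight T l)
    (hM : ∀ χ, weightSpace T M χ ≠ ⊥ → χ ∈ W T ∨ χ = 0) {f : N →ₗ[ℂ] N →ₗ[ℂ] M}
    (hf : IsInvariantCocycle T f) {t : T} (ht : ∀ l ∈ W T, ∃ n : ℕ, l t = n + 1) {n : ℕ}
    (hn : VanishesBelow t n f) :
    ∃ g : N →ₗ[ℂ] M, IsEquivariant T g ∧ VanishesBelow t (n + 1) (f - coboundary T g) := by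
  classical
  have key : ∀ l : Module.Dual ℂ T, ∃ g : N →ₗ[ℂ] M, (∀ x, g x ∈ weightSpace T M l) ∧
      (∀ β ≠ l, ∀ x ∈ rootSpace T β, g x = 0) ∧ (l ∈ W T → l t = n → ∀ α β, α + β = l →
        ∀ x ∈ rootSpace T α, ∀ y ∈ rootSpace T β, f x y = g ⁅x, y⁆) := by
    intro l
    by_cases hl : l ∈ W T ∧ l t = n ∧ l ∉ primitive T
    · obtain ⟨hl, hln, hp⟩ := hl
      obtain ⟨g, h1, h2, h3⟩ := (hf.isCocycleAt ht hn hln).exists_eq_comp_lie hT hl hp (hW l hl)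
        (weightSpace T M l) (fun α β h x hx y hy => h ▸ hf.mem_weightSpace hx hy)
      exact ⟨g, h1, h2, fun _ _ => h3⟩
    · refine ⟨0, fun x => Submodule.zero_mem _, fun β _ x _ => rfl, ?_⟩
      intro hlW hln α β h x hx y hy
      -- A primitive weight is not a sum of two weights, so `f x y = 0`.
      have hp : l ∈ primitive T := by tauto
      rw [LinearMap.zero_apply]
      by_contra h0
      have hx0 : x ≠ 0 := by rintro rfl; simp at h0
      have hy0 : y ≠ 0 := by rintro rfl; simp at h0
      exact hT.add_notMem_primitive (mem_W_of_ne_zero hx hx0) (mem_W_of_ne_zero hy hy0) (h ▸ hp)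
  choose G hG1 hG2 hG3 using key
  let S : Finset (Module.Dual ℂ T) := (finite_W hT.isTorus).toFinset.filter fun l => l t = n
  have hS : ∀ l, l ∈ S ↔ l ∈ W T ∧ l t = n := fun l => by simp [S]
  let g : N →ₗ[ℂ] M := -∑ l ∈ S, G l
  have hg0 : ∀ β : Module.Dual ℂ T, β t ≠ (n : ℂ) → ∀ x ∈ rootSpace T β, g x = 0 := by
    intro β hβ x hx
    rw [LinearMap.neg_apply, LinearMap.sum_apply, Finset.sum_eq_zero, neg_zero]
    refine fun l hl => hG2 l β ?_ x hx
    rintro rfl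
    exact hβ ((hS _).1 hl).2
  have hg1 : ∀ β ∈ W T, β t = n → ∀ x ∈ rootSpace T β, g x = -G β x := fun β hβ hβn x hx => by
    rw [LinearMap.neg_apply, LinearMap.sum_apply, Finset.sum_eq_single β]
    · exact fun l _ hne => hG2 l β hne.symm x hx
    · exact fun h => absurd ((hS β).2 ⟨hβ, hβn⟩) h
  refine ⟨g, fun s x => ?_, fun α β k hk hαβ x hx y hy => ?_⟩
  · simp only [g, LinearMap.neg_apply, LinearMap.sum_apply, lie_neg, lie_sum]
    rw [Finset.sum_congr rfl fun l _ =>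
      isEquivariant_of_weight hT.isTorus (hG1 l) (hG2 l) s x]
  · by_cases hx0 : x = 0
    · simp [hx0]
    by_cases hy0 : y = 0
    · simp [hy0]
    obtain ⟨a, ha⟩ := ht α (mem_W_of_ne_zero hx hx0)
    obtain ⟨b, hb⟩ := ht β (mem_W_of_ne_zero hy hy0)
    have hab : a + 1 + (b + 1) = k := by
      rw [LinearMap.add_apply, ha, hb] at hαβ
      exact_mod_cast hαβ
    have hgx : g x = 0 := hg0 α (by rw [ha]; norm_cast; omega) x hx
    have hgy : g y = 0 := hg0 β (by rw [hb]; norm_cast; omega) y hy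
    rw [LinearMap.sub_apply, LinearMap.sub_apply, coboundary_apply, hgx, hgy, lie_zero, lie_zero,
      sub_self, zero_sub, sub_neg_eq_add]
    have hxy := lie_mem_rootSpace hx hy
    rcases Nat.lt_succ_iff_lt_or_eq.1 hk with hk | rfl
    · rw [hn α β k hk hαβ x hx y hy, hg0 _ (by rw [hαβ]; norm_cast; omega) _ hxy, add_zero]
    · by_cases hαβW : α + β ∈ W T
      · rw [hg1 _ hαβW hαβ _ hxy, hG3 _ hαβW hαβ α β rfl x hx y hy, add_neg_cancel]
      · rw [hf.eq_zero_of_notMem_W hT hM hx hy hαβW, MaxRank.eq_zero_of_notMem_W hαβW hxy,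
          map_zero, add_zero]

/-- The vanishing theorem at the level of invariant cochains. The module may also have the weight
`0`, so that it applies to the adjoint module of `N ⋊ T`. -/
theorem IsInvariantCocycle.exists_eq_coboundary (hT : IsMaxRank T)
    (hW : ∀ l ∈ W T, LegerLuks T l ∨ UniqueDecomposition T l ∨ ShortWeight T l)
    (hM : ∀ χ, weightSpace T M χ ≠ ⊥ → χ ∈ W T ∨ χ = 0) {f : N →ₗ[ℂ] N →ₗ[ℂ] M}
    (hf : IsInvariantCocycle T f) : ∃ g : N →ₗ[ℂ] M, IsEquivariant T g ∧ f = coboundary T g := by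
  obtain ⟨t, -, ht⟩ := hT.exists_height
  have key : ∀ n : ℕ, ∃ g : N →ₗ[ℂ] M, IsEquivariant T g ∧
      VanishesBelow t n (f - coboundary T g) := by
    intro n
    induction n with
    | zero => exact ⟨0, fun s x => by simp, fun _ _ k hk => absurd hk (Nat.not_lt_zero k)⟩
    | succ n ih =>
      obtain ⟨g, hg, hn⟩ := ih
      obtain ⟨g', hg', hn'⟩ :=
        (hf.sub_coboundary hg).exists_vanishesBelow_succ hT hW hM ht hn
      refine ⟨g + g', fun s x => ?_, ?_⟩
      · rw [LinearMap.add_apply, lie_add, hg, hg', LinearMap.add_apply]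
      · rwa [coboundary_add, ← sub_sub]
  -- All heights of weights are less than `n`.
  obtain ⟨n, hn⟩ : ∃ n : ℕ, ∀ l ∈ W T, ∃ k < n, l t = (k : ℕ) := by
    refine ⟨(finite_W hT.isTorus).toFinset.sup (fun l => ⌊(l t).re⌋₊) + 1, fun l hl => ?_⟩
    obtain ⟨k, hk⟩ := ht l hl
    refine ⟨k + 1, Nat.lt_succ_of_le ?_, by rw [hk]; push_cast; rfl⟩
    have h := Finset.le_sup (f := fun l : Module.Dual ℂ T => ⌊(l t).re⌋₊)
      ((finite_W hT.isTorus).mem_toFinset.2 hl)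
    have h' : ⌊(l t).re⌋₊ = k + 1 := by
      rw [hk, show ((k : ℂ) + 1).re = ((k + 1 : ℕ) : ℝ) by simp, Nat.floor_natCast]
    rwa [h'] at h
  obtain ⟨g, hg, hvan⟩ := key n
  refine ⟨g, hg, sub_eq_zero.1 ?_⟩
  refine ext_rootSpace hT.isTorus fun α _ x hx => ext_rootSpace hT.isTorus fun β _ y hy => ?_
  by_cases hαβ : α + β ∈ W T
  · obtain ⟨k, hk, hk'⟩ := hn _ hαβ
    exact hvan α β k hk hk' x hx y hy
  · exact (hf.sub_coboundary hg).eq_zero_of_notMem_W hT hM hx hy hαβ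

end InvariantCocycles

/-! ### Passing to invariants under commuting semisimple operators -/

section Invariants

open Polynomial

variable {V : Type*} [AddCommGroup V] [Module ℂ V]

theorem aeval_apply_mem {f : Module.End ℂ V} {Z : Submodule ℂ V} (hZ : ∀ v ∈ Z, f v ∈ Z)
    (p : ℂ[X]) : ∀ v ∈ Z, aeval f p v ∈ Z := by
  induction p using Polynomial.induction_on' with
  | add p q hp hq =>
    intro v hv
    rw [map_add, LinearMap.add_apply]
    exact Z.add_mem (hp v hv) (hq v hv)
  | monomial n a =>
    intro v hv
    rw [aeval_monomial, Module.End.mul_apply, Module.algebraMap_end_apply]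
    refine Z.smul_mem a ?_
    induction n with
    | zero => simpa using hv
    | succ n ih =>
      rw [pow_succ', Module.End.mul_apply]
      exact hZ _ ih

variable [FiniteDimensional ℂ V]

/-- For a semisimple `f`, the projection to `ker f` along the range of `f` is a polynomial `p(f)`
with `p(0) = 1`. -/
theorem exists_polynomial_projection_ker {f : Module.End ℂ V} (hf : f.IsSemisimple) :
    ∃ p q : ℂ[X], f * aeval f p = 0 ∧ 1 - p = q * X := by
  have hm := hf.minpoly_squarefree
  obtain ⟨r, hr0, hr⟩ : ∃ r : ℂ[X], r.coeff 0 ≠ 0 ∧ aeval f (X * r) = 0 := by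
    by_cases h : X ∣ minpoly ℂ f
    · obtain ⟨r, hr⟩ := h
      refine ⟨r, fun h0 => ?_, by rw [← hr, minpoly.aeval]⟩
      obtain ⟨s, rfl⟩ := X_dvd_iff.2 h0
      exact not_isUnit_X (hm X ⟨s, by rw [hr, mul_assoc]⟩)
    · exact ⟨minpoly ℂ f, fun h0 => h (X_dvd_iff.2 h0), by rw [map_mul, minpoly.aeval, mul_zero]⟩
  rw [map_mul, aeval_X] at hr
  obtain ⟨q, hq⟩ : X ∣ 1 - C (r.coeff 0)⁻¹ * r := by
    rw [X_dvd_iff, coeff_sub, coeff_C_mul, inv_mul_cancel₀ hr0, coeff_one_zero, sub_self]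
  refine ⟨C (r.coeff 0)⁻¹ * r, q, ?_, by rw [hq, mul_comm]⟩
  rw [map_mul, aeval_C, ← mul_assoc, ← Algebra.commutes, mul_assoc, hr, mul_zero]

/-- Let commuting semisimple operators preserve `B` and `Z`. If they all map `v ∈ Z` into `B`, then
`v` is congruent modulo `B` to an element of `Z` that they annihilate. -/
theorem exists_annihilated_sub_mem {S : Type*} [AddCommGroup S] [Module ℂ S]
    [FiniteDimensional ℂ S] (L : S →ₗ[ℂ] Module.End ℂ V) (hcomm : ∀ s t, Commute (L s) (L t))
    (hss : ∀ s, (L s).IsSemisimple) {Z B : Submodule ℂ V} (hZ : ∀ s, ∀ v ∈ Z, L s v ∈ Z)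
    (hB : ∀ s, ∀ v ∈ B, L s v ∈ B) {v : V} (hv : v ∈ Z) (hvB : ∀ s, L s v ∈ B) :
    ∃ w ∈ Z, (∀ s, L s w = 0) ∧ v - w ∈ B := by
  classical
  have key : ∀ F : Finset S, ∃ w ∈ Z, (∀ s ∈ F, L s w = 0) ∧ v - w ∈ B := by
    intro F
    induction F using Finset.induction_on with
    | empty => exact ⟨v, hv, by simp, by simp⟩
    | insert a F _ ih =>
      obtain ⟨w, hw, hF, hwB⟩ := ih
      obtain ⟨p, q, hp, hq⟩ := exists_polynomial_projection_ker (hss a)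
      refine ⟨aeval (L a) p w, aeval_apply_mem (hZ a) p w hw, ?_, ?_⟩
      · intro s hs
        rcases Finset.mem_insert.1 hs with rfl | hs
        · exact LinearMap.congr_fun hp w
        · have hc : Commute (L s) (aeval (L a) p) :=
            Algebra.commute_of_mem_adjoin_singleton_of_commute
              (aeval_mem_adjoin_singleton ℂ (L a)) (hcomm s a)
          have := LinearMap.congr_fun hc.eq w
          rw [Module.End.mul_apply, Module.End.mul_apply, hF s hs, map_zero] at this
          exact this
      · have h1 : w - aeval (L a) p w = aeval (L a) q (L a w) := by
          have := congrArg (fun r => aeval (L a) r w) hq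
          simpa using this
        have h2 : L a w ∈ B := by
          have := B.sub_mem (hvB a) (hB a _ hwB)
          rwa [map_sub, sub_sub_cancel] at this
        have h3 := B.add_mem hwB (h1 ▸ aeval_apply_mem (hB a) q _ h2)
        rwa [sub_add_sub_cancel] at h3
  obtain ⟨F, hF⟩ := (Module.Finite.fg_top : (⊤ : Submodule ℂ S).FG)
  obtain ⟨w, hw, hw0, hwB⟩ := key F
  refine ⟨w, hw, fun s => ?_, hwB⟩
  have : (⊤ : Submodule ℂ S) ≤ LinearMap.ker (L.flip w) := by
    rw [← hF, Submodule.span_le]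
    exact hw0
  exact this (Submodule.mem_top (x := s))

end Invariants

/-! ### The action of a torus on bilinear maps -/

section Bilinear

open Polynomial

variable {L M : Type*} [AddCommGroup L] [Module ℂ L] [AddCommGroup M] [Module ℂ M]

/-- Representations on a space `U` preserve semisimplicity. Multiplicativity is needed on commuting
pairs only, so that composition on the right, which reverses products, is covered as well. -/
theorem isSemisimple_of_map {V U : Type*} [AddCommGroup V] [Module ℂ V] [FiniteDimensional ℂ V]
    [AddCommGroup U] [Module ℂ U]
    (Φ : Module.End ℂ V →ₗ[ℂ] Module.End ℂ U) (h1 : Φ 1 = 1)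
    (hmul : ∀ a b, Commute a b → Φ (a * b) = Φ a * Φ b) {a : Module.End ℂ V}
    (ha : a.IsSemisimple) : (Φ a).IsSemisimple := by
  have key : ∀ p : ℂ[X], aeval (Φ a) p = Φ (aeval a p) := by
    intro p
    induction p using Polynomial.induction_on' with
    | add p q hp hq => rw [map_add, map_add, map_add, hp, hq]
    | monomial n c =>
      rw [aeval_monomial, aeval_monomial, ← Algebra.smul_def, ← Algebra.smul_def, map_smul]
      congr 1
      induction n with
      | zero => rw [pow_zero, pow_zero, h1]
      | succ n ih => rw [pow_succ, pow_succ, hmul _ _ ((Commute.refl a).pow_left n), ih]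
  refine Module.End.isSemisimple_of_squarefree_aeval_eq_zero ha.minpoly_squarefree ?_
  rw [key, minpoly.aeval, map_zero]

variable (L M) in
/-- Composition with endomorphisms of the target, as an action on bilinear maps. -/
def postcomp : Module.End ℂ M →ₗ[ℂ] Module.End ℂ (L →ₗ[ℂ] L →ₗ[ℂ] M) :=
  LinearMap.mk₂ ℂ (fun A f => f.compr₂ A) (fun _ _ _ => rfl) (fun _ _ _ => rfl)
    (fun A _ _ => LinearMap.ext₂ fun _ _ => map_add A _ _)
    (fun _ A _ => LinearMap.ext₂ fun _ _ => map_smul A _ _)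

variable (L M) in
/-- Composition with endomorphisms of the first variable, as an action on bilinear maps. -/
def precompLeft : Module.End ℂ L →ₗ[ℂ] Module.End ℂ (L →ₗ[ℂ] L →ₗ[ℂ] M) :=
  LinearMap.mk₂ ℂ (fun D f => f.comp D)
    (fun _ _ f => LinearMap.ext fun _ => map_add f _ _)
    (fun _ _ f => LinearMap.ext fun _ => map_smul f _ _) (fun _ _ _ => rfl) (fun _ _ _ => rfl)

variable (L M) in
/-- Composition with endomorphisms of the second variable, as an action on bilinear maps. -/
def precompRight : Module.End ℂ L →ₗ[ℂ] Module.End ℂ (L →ₗ[ℂ] L →ₗ[ℂ] M) :=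
  LinearMap.mk₂ ℂ (fun D f => f.compl₂ D)
    (fun _ _ f => LinearMap.ext₂ fun x _ => map_add (f x) _ _)
    (fun _ _ f => LinearMap.ext₂ fun x _ => map_smul (f x) _ _) (fun _ _ _ => rfl)
    (fun _ _ _ => rfl)

variable {S : Type*} [AddCommGroup S] [Module ℂ S]

/-- The action `(s f)(x, y) = A(s) f(x, y) - f(D(s) x, y) - f(x, D(s) y)` on bilinear maps induced
by linear families `D`, `A` of endomorphisms of the source and of the target. -/
def bilinAct (D : S →ₗ[ℂ] Module.End ℂ L) (A : S →ₗ[ℂ] Module.End ℂ M) :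
    S →ₗ[ℂ] Module.End ℂ (L →ₗ[ℂ] L →ₗ[ℂ] M) :=
  LinearMap.mk₂ ℂ (fun s f => f.compr₂ (A s) - f.comp (D s) - f.compl₂ (D s))
    (fun s t f => LinearMap.ext₂ fun x y => by simp; abel)
    (fun c s f => LinearMap.ext₂ fun x y => by simp [smul_sub])
    (fun s f g => LinearMap.ext₂ fun x y => by simp; abel)
    (fun c s f => LinearMap.ext₂ fun x y => by simp [smul_sub])

variable {D : S →ₗ[ℂ] Module.End ℂ L} {A : S →ₗ[ℂ] Module.End ℂ M}

theorem bilinAct_apply (s : S) (f : L →ₗ[ℂ] L →ₗ[ℂ] M) (x y : L) :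
    bilinAct D A s f x y = A s (f x y) - f (D s x) y - f x (D s y) := rfl

theorem commute_bilinAct (hD : ∀ s t, Commute (D s) (D t)) (hA : ∀ s t, Commute (A s) (A t))
    (s t : S) : Commute (bilinAct D A s) (bilinAct D A t) := by
  refine LinearMap.ext fun f => LinearMap.ext₂ fun x y => ?_
  have hD' : ∀ x, D s (D t x) = D t (D s x) := LinearMap.congr_fun (hD s t)
  have hA' : ∀ x, A s (A t x) = A t (A s x) := LinearMap.congr_fun (hA s t)
  simp only [Module.End.mul_apply, bilinAct_apply, map_sub, hD', hA']
  abel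

theorem isSemisimple_bilinAct [FiniteDimensional ℂ L] [FiniteDimensional ℂ M] {s : S}
    (hD : (D s).IsSemisimple) (hA : (A s).IsSemisimple) : (bilinAct D A s).IsSemisimple := by
  have h1 : (postcomp L M (A s)).IsSemisimple :=
    isSemisimple_of_map (postcomp L M) rfl (fun _ _ _ => rfl) hA
  have h2 : (precompLeft L M (D s)).IsSemisimple :=
    isSemisimple_of_map (precompLeft L M) rfl (fun a b h => by rw [h.eq]; rfl) hD
  have h3 : (precompRight L M (D s)).IsSemisimple :=
    isSemisimple_of_map (precompRight L M) rfl (fun a b h => by rw [h.eq]; rfl) hD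
  have c1 : Commute (postcomp L M (A s)) (precompLeft L M (D s)) := LinearMap.ext fun _ => rfl
  have c2 : Commute (postcomp L M (A s)) (precompRight L M (D s)) := LinearMap.ext fun _ => rfl
  have c3 : Commute (precompLeft L M (D s)) (precompRight L M (D s)) := LinearMap.ext fun _ => rfl
  have c4 : Commute (postcomp L M (A s) - precompLeft L M (D s)) (precompRight L M (D s)) :=
    LinearMap.ext fun _ => rfl
  have : bilinAct D A s =
      postcomp L M (A s) - precompLeft L M (D s) - precompRight L M (D s) := rfl
  rw [this]
  exact Module.End.IsSemisimple.sub_of_commute c4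
    (Module.End.IsSemisimple.sub_of_commute c1 h1 h2) h3

end Bilinear

/-! ### Invariant cohomology classes of `N` -/

section InvariantClasses

open LieModule.Cohomology

/-- A 2-cochain as a bilinear map. -/
def toBilin (L M : Type*) [LieRing L] [LieAlgebra ℂ L] [AddCommGroup M] [Module ℂ M] :
    C2 L M →ₗ[ℂ] L →ₗ[ℂ] L →ₗ[ℂ] M := (twoCochain ℂ L M).subtype

theorem toBilin_injective (L M : Type*) [LieRing L] [LieAlgebra ℂ L] [AddCommGroup M]
    [Module ℂ M] : Function.Injective (toBilin L M) :=
  (twoCochain ℂ L M).injective_subtype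

variable {N : Type*} [LieRing N] [LieAlgebra ℂ N]

/-- The elements of `T` as endomorphisms of `N`. -/
def torusEnd (T : LieSubalgebra ℂ (LieDerivation ℂ N N)) : T →ₗ[ℂ] Module.End ℂ N where
  toFun t := ((t : LieDerivation ℂ N N) : N →ₗ[ℂ] N)
  map_add' _ _ := rfl
  map_smul' _ _ := rfl

variable (T : LieSubalgebra ℂ (LieDerivation ℂ N N))
variable (M : Type*) [AddCommGroup M] [Module ℂ M]
variable [LieRingModule (SolvExt T) M] [LieModule ℂ (SolvExt T) M]

/-- The elements of `T` as endomorphisms of the module `M`. -/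
def moduleEnd : T →ₗ[ℂ] Module.End ℂ M :=
  (LieModule.toEnd ℂ (SolvExt T) M : SolvExt T →ₗ[ℂ] Module.End ℂ M).comp
    (inT T : T →ₗ[ℂ] SolvExt T)

variable {T M}

theorem commute_moduleEnd (hT : IsTorus T) (s t : T) :
    Commute (moduleEnd T M s) (moduleEnd T M t) := by
  have h : ⁅s, t⁆ = 0 := Subtype.ext (hT.1 s s.2 t t.2)
  refine LinearMap.ext fun m => ?_
  change ⁅inT T s, ⁅inT T t, m⁆⁆ = ⁅inT T t, ⁅inT T s, m⁆⁆
  rw [leibniz_lie, ← LieHom.map_lie, h, map_zero, zero_lie, zero_add]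

theorem isSemisimple_moduleEnd [FiniteDimensional ℂ M] (hM : IsDiagonalModule T M) (t : T) :
    (moduleEnd T M t).IsSemisimple := by
  refine isSemisimple_of_iSup_eigenspace_eq_top ?_
  rw [eq_top_iff, ← show _ = ⊤ from hM, iSup_le_iff]
  exact fun α m hm => Submodule.mem_iSup_of_mem (α t) (Module.End.mem_eigenspace_iff.2 (hm t))

variable [FiniteDimensional ℂ N] [FiniteDimensional ℂ M]

theorem H2Inv_eq_bot (hT : IsMaxRank T)
    (hW : ∀ l ∈ W T, LegerLuks T l ∨ UniqueDecomposition T l ∨ ShortWeight T l)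
    (hM : IsDiagonalModule T M) (hMW : WeightsIn T M) : H2Inv T M = ⊥ := by
  have := hT.finiteDimensional_torus
  rw [Submodule.eq_bot_iff]
  intro c hc
  obtain ⟨⟨f, hf⟩, rfl⟩ := Submodule.Quotient.mk_surjective _ c
  have hinv : ∀ t, cochainAct T M t f ∈ coboundariesN T M := fun t => by
    have h := (Submodule.mem_iInf _).1 hc t
    rw [LinearMap.mem_ker] at h
    exact (Submodule.Quotient.mk_eq_zero ((coboundariesN T M).submoduleOf (cocyclesN T M))
      (x := cocycleAct T M t ⟨f, hf⟩)).1 h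
  have hact : ∀ t (g : C2 N M), bilinAct (torusEnd T) (moduleEnd T M) t (toBilin N M g) =
      toBilin N M (cochainAct T M t g) := fun t g => rfl
  obtain ⟨_, ⟨g, hg, rfl⟩, hg0, h, hh, hhg⟩ := exists_annihilated_sub_mem
    (bilinAct (torusEnd T) (moduleEnd T M))
    (commute_bilinAct (commute_of_isTorus hT.isTorus) (commute_moduleEnd hT.isTorus))
    (fun t => isSemisimple_bilinAct (isSemisimple_of_isTorus hT.isTorus t)
      (isSemisimple_moduleEnd hM t))
    (Z := (cocyclesN T M).map (toBilin N M)) (B := (coboundariesN T M).map (toBilin N M))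
    (fun t _ ⟨g, hg, h⟩ => h ▸ ⟨_, cochainAct_mem_cocyclesN T M t g hg, (hact t g).symm⟩)
    (fun t _ ⟨g, hg, h⟩ => h ▸ ⟨_, cochainAct_mem_coboundariesN T M t g hg, (hact t g).symm⟩)
    (Submodule.mem_map_of_mem hf) (fun t => ⟨_, hinv t, (hact t f).symm⟩)
  rw [← map_sub] at hhg
  have hfg : f - g ∈ coboundariesN T M := toBilin_injective N M hhg ▸ hh
  have hgc : IsInvariantCocycle T (toBilin N M g) :=
    { self_eq_zero := ev_self g
      invariant := fun t x y => by
        have := LinearMap.congr_fun₂ (hg0 t) x y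
        rw [bilinAct_apply, sub_sub] at this
        exact sub_eq_zero.1 this
      cocycle := (mem_cocyclesN T M g).1 hg }
  obtain ⟨u, -, hu⟩ := hgc.exists_eq_coboundary hT hW fun χ h => Or.inl (hMW χ h)
  have hgB : g ∈ coboundariesN T M :=
    (mem_coboundariesN T M g).2 ⟨u, fun x y => LinearMap.congr_fun₂ hu x y⟩
  refine (Submodule.Quotient.mk_eq_zero _).2 ?_
  change f ∈ coboundariesN T M
  have := Submodule.add_mem _ hfg hgB
  rwa [sub_add_cancel] at this

end InvariantClasses

/-! ### Rigidity of the solvable extension -/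

section Rigidity

open LieModule.Cohomology

variable {N : Type*} [LieRing N] [LieAlgebra ℂ N] {T : LieSubalgebra ℂ (LieDerivation ℂ N N)}

theorem mem_Z2_iff {L : Type*} [LieRing L] [LieAlgebra ℂ L] (f : C2 L L) :
    f ∈ Z2 L L ↔ ∀ x y z : L, ⁅x, f y z⁆ - ⁅y, f x z⁆ + ⁅z, f x y⁆
      - f ⁅x, y⁆ z + f ⁅x, z⁆ y - f ⁅y, z⁆ x = 0 := by
  refine (mem_twoCocycle_iff ℂ L L f).trans ⟨fun h x y z => ?_, fun h => ?_⟩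
  · exact LinearMap.congr_fun (LinearMap.congr_fun (LinearMap.congr_fun h x) y) z
  · ext x y z
    exact h x y z

theorem B2_le_Z2 (L : Type*) [LieRing L] [LieAlgebra ℂ L] : B2 L L ≤ Z2 L L := by
  rintro _ ⟨g, rfl⟩
  exact LinearMap.congr_fun (d₂₃_comp_d₁₂ ℂ L L) g

/-- Cartan's formula `t • f = d (f(t, ·))` for a 2-cocycle `f` of `N ⋊ T` and `t ∈ T`. -/
theorem bilinAct_cocycle {f : C2 (SolvExt T) (SolvExt T)} (hf : f ∈ Z2 (SolvExt T) (SolvExt T))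
    (t : T) : bilinAct (moduleEnd T (SolvExt T)) (moduleEnd T (SolvExt T)) t
      (toBilin (SolvExt T) (SolvExt T) f) =
      toBilin (SolvExt T) (SolvExt T) (d₁₂ ℂ (SolvExt T) (SolvExt T) (f (inT T t))) := by
  refine LinearMap.ext₂ fun x y => ?_
  have h := (mem_Z2_iff f).1 hf (inT T t) x y
  change ⁅inT T t, f x y⁆ - f ⁅inT T t, x⁆ y - f x ⁅inT T t, y⁆ =
    ⁅x, f (inT T t) y⁆ - ⁅y, f (inT T t) x⁆ - f (inT T t) ⁅x, y⁆
  rw [ev_skew f ⁅inT T t, y⁆ x, ev_skew f ⁅x, y⁆ (inT T t)] at h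
  linear_combination (norm := module) h

theorem eq_inN_add_inT (r : SolvExt T) : r = inN T r.left + inT T r.right := by
  ext <;> simp

theorem lie_inT_inN (t : T) (x : N) :
    ⁅inT T t, inN T x⁆ = inN T ((t : LieDerivation ℂ N N) x) := by simp

theorem lie_inT_inT (hT : IsTorus T) (s t : T) : ⁅inT T s, inT T t⁆ = 0 := by
  rw [← LieHom.map_lie, show ⁅s, t⁆ = 0 from Subtype.ext (hT.1 s s.2 t t.2), map_zero]

theorem lie_inT (hT : IsTorus T) (t : T) (r : SolvExt T) :
    ⁅inT T t, r⁆ = inN T ((t : LieDerivation ℂ N N) r.left) := by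
  conv_lhs => rw [eq_inN_add_inT r, lie_add, lie_inT_inN, lie_inT_inT hT, add_zero]

theorem inN_mem_weightSpace {α : Module.Dual ℂ T} {x : N} (hx : x ∈ rootSpace T α) :
    inN T x ∈ weightSpace T (SolvExt T) α := fun t => by
  rw [lie_inT_inN, hx t, map_smul]

theorem inT_mem_weightSpace (hT : IsTorus T) (s : T) :
    inT T s ∈ weightSpace T (SolvExt T) 0 := fun t => by
  rw [lie_inT_inT hT, LinearMap.zero_apply, zero_smul]

theorem left_mem_rootSpace (hT : IsTorus T) {α : Module.Dual ℂ T} {r : SolvExt T}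
    (hr : r ∈ weightSpace T (SolvExt T) α) : r.left ∈ rootSpace T α := fun t => by
  have h := hr t
  rw [lie_inT hT] at h
  exact congrArg LieAlgebra.SemiDirectSum.left h

theorem right_eq_zero (hT : IsTorus T) {α : Module.Dual ℂ T} (hα : α ≠ 0) {r : SolvExt T}
    (hr : r ∈ weightSpace T (SolvExt T) α) : r.right = 0 := by
  obtain ⟨t, ht⟩ : ∃ t, α t ≠ 0 := by
    by_contra! h
    exact hα (LinearMap.ext h)
  have h := hr t
  rw [lie_inT hT] at h
  have h' : 0 = α t • r.right := congrArg LieAlgebra.SemiDirectSum.right h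
  exact (smul_eq_zero.1 h'.symm).resolve_left ht

theorem mem_W_or_eq_zero (hT : IsTorus T) (χ : Module.Dual ℂ T)
    (h : weightSpace T (SolvExt T) χ ≠ ⊥) : χ ∈ W T ∨ χ = 0 := by
  by_contra! hχ
  obtain ⟨r, hr, h0⟩ := (Submodule.ne_bot_iff _).1 h
  refine h0 ?_
  rw [eq_inN_add_inT r, right_eq_zero hT hχ.2 hr,
    eq_zero_of_notMem_W hχ.1 (left_mem_rootSpace hT hr), map_zero, map_zero, add_zero]

variable [FiniteDimensional ℂ N]

theorem isDiagonalModule_solvExt (hT : IsTorus T) : IsDiagonalModule T (SolvExt T) := by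
  refine eq_top_iff.2 fun r _ => ?_
  rw [eq_inN_add_inT r]
  refine Submodule.add_mem _ ?_ (Submodule.mem_iSup_of_mem 0 (inT_mem_weightSpace hT _))
  have h : (⨆ α, weightSpace T (SolvExt T) α).comap (inN T : N →ₗ[ℂ] SolvExt T) = ⊤ :=
    eq_top_of_rootSpace_le hT fun α _ x hx =>
      Submodule.mem_iSup_of_mem α (inN_mem_weightSpace hx)
  exact (h.symm ▸ Submodule.mem_top :
    r.left ∈ (⨆ α, weightSpace T (SolvExt T) α).comap (inN T : N →ₗ[ℂ] SolvExt T))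

/-- An invariant 2-cocycle of `N ⋊ T` is a coboundary. For `t ∈ T`, the map `f(t, ·)` is a
derivation that preserves weights, hence vanishes on `T` and is the bracket with some `φ(t) ∈ T`
on `N`, because the rank is maximal. The restriction of `f` to `N` is a coboundary by the vanishing
theorem for `N`. -/
theorem mem_B2_of_invariant (hT : IsMaxRank T)
    (hW : ∀ l ∈ W T, LegerLuks T l ∨ UniqueDecomposition T l ∨ ShortWeight T l)
    {f : C2 (SolvExt T) (SolvExt T)} (hf : f ∈ Z2 (SolvExt T) (SolvExt T))
    (hinv : ∀ (t : T) (r s : SolvExt T),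
      ⁅inT T t, f r s⁆ = f ⁅inT T t, r⁆ s + f r ⁅inT T t, s⁆) :
    f ∈ B2 (SolvExt T) (SolvExt T) := by
  have htor := hT.isTorus
  rw [mem_Z2_iff] at hf
  have hfz : ∀ s, f 0 s = 0 := fun s => by
    have h := ev_smul_left f 0 0
    rw [zero_smul, zero_smul] at h
    rw [h, LinearMap.zero_apply]
  have hweight : ∀ (s : T) {α : Module.Dual ℂ T} {x : N}, x ∈ rootSpace T α →
      f (inT T s) (inN T x) ∈ weightSpace T (SolvExt T) α := fun s α x hx t => by
    rw [hinv, lie_inT_inT htor, hfz, zero_add, lie_inT_inN, hx t, map_smul, map_smul]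
  -- `f` vanishes on `T × T`.
  have hTT : ∀ s t : T, f (inT T s) (inT T t) = 0 := by
    intro s t
    have h0 : f (inT T s) (inT T t) ∈ weightSpace T (SolvExt T) 0 := fun u => by
      rw [hinv, lie_inT_inT htor, lie_inT_inT htor, hfz, map_zero, zero_add,
        LinearMap.zero_apply, zero_smul]
    obtain ⟨u, hu⟩ : ∃ u : T, f (inT T s) (inT T t) = inT T u := by
      refine ⟨(f (inT T s) (inT T t)).right, (eq_inN_add_inT _).trans ?_⟩
      rw [eq_zero_of_notMem_W hT.zero_notMem_W (left_mem_rootSpace htor h0), map_zero, zero_add]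
    have hux : ∀ α ∈ primitive T, α u = 0 := by
      intro α hα
      obtain ⟨x, hx, hx0⟩ := exists_mem_rootSpace_ne_zero hα.1
      have h := hf (inT T s) (inT T t) (inN T x)
      rw [hweight t hx s, hweight s hx t, hu, lie_inT_inT htor, hfz, lie_inT_inN, lie_inT_inN,
        hx s, hx t, map_smul (inN T), map_smul (inN T), ev_smul_left, ev_smul_left,
        LinearMap.smul_apply, LinearMap.smul_apply, ev_skew f (inN T x) (inT T t),
        ev_skew f (inN T x) (inT T s), ← lie_skew, lie_inT_inN, hx u] at h
      have h' : inN T (α u • x) = 0 := by linear_combination (norm := module) -h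
      have h'' : α u • x = 0 :=
        LieAlgebra.SemiDirectSum.inl_injective T.incl (h'.trans (map_zero _).symm)
      exact (smul_eq_zero.1 h'').resolve_right hx0
    have hu0 : u = 0 := hT.ext_torus fun α hα => by rw [hux α hα, map_zero]
    rw [hu, hu0, map_zero]
  -- `f(t, ·)` is on `N` the bracket with an element of `T`.
  have hTN : ∀ t : T, ∃ s : T, ∀ x : N, f (inT T t) (inN T x) = ⁅inT T s, inN T x⁆ := by
    intro t
    have hc : ∀ α : Module.Dual ℂ T, ∃ c : ℂ, α ∈ primitive T →
        ∀ x ∈ rootSpace T α, f (inT T t) (inN T x) = c • inN T x := by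
      intro α
      by_cases hα : α ∈ primitive T
      · obtain ⟨e, he, he0⟩ := exists_mem_rootSpace_ne_zero hα.1
        have hw := hweight t he
        obtain ⟨c, hc⟩ := hT.exists_smul_eq he he0 (left_mem_rootSpace htor hw)
        refine ⟨c, fun _ x hx => ?_⟩
        obtain ⟨d, rfl⟩ := hT.exists_smul_eq he he0 hx
        have hα0 : α ≠ 0 := by
          rintro rfl
          exact hT.zero_notMem_W hα.1
        have h1 : f (inT T t) (inN T e) = c • inN T e := by
          rw [eq_inN_add_inT (f (inT T t) (inN T e)), right_eq_zero htor hα0 hw, hc, map_zero,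
            add_zero, map_smul]
        rw [map_smul, map_smul, h1, smul_comm]
      · exact ⟨0, fun h => absurd h hα⟩
    choose c hc using hc
    obtain ⟨s, hs⟩ := hT.exists_torus_eq c
    refine ⟨s, ?_⟩
    let U : Submodule ℂ N := LinearMap.eqLocus ((f (inT T t)).comp (inN T : N →ₗ[ℂ] SolvExt T))
      ((moduleEnd T (SolvExt T) s).comp (inN T : N →ₗ[ℂ] SolvExt T))
    have hU : U = ⊤ := by
      refine hT.eq_top_of_primitive (fun α hα x hx => ?_) (fun α hα x hx y hy => ?_)
      · change f (inT T t) (inN T x) = ⁅inT T s, inN T x⁆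
        rw [hc α hα x hx, lie_inT_inN, hx s, hs α hα, map_smul]
      · change f (inT T t) (inN T ⁅x, y⁆) = ⁅inT T s, inN T ⁅x, y⁆⁆
        have hy' : f (inT T t) (inN T y) = ⁅inT T s, inN T y⁆ := hy
        have hx' : f (inT T t) (inN T x) = ⁅inT T s, inN T x⁆ := by
          rw [hc α hα x hx, lie_inT_inN, hx s, hs α hα, map_smul]
        have h := hf (inT T t) (inN T x) (inN T y)
        rw [hinv, hx', hy', ev_skew f ⁅inN T x, inN T y⁆ (inT T t), ev_skew f ⁅inT T t, inN T y⁆]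
          at h
        rw [LieHom.map_lie, leibniz_lie, ← lie_skew ⁅inT T s, inN T x⁆ (inN T y)]
        linear_combination (norm := module) h
    exact fun x => (hU.symm ▸ Submodule.mem_top : x ∈ U)
  choose φ hφ using hTN
  have hφ_eq : ∀ s t : T, (∀ x : N, ⁅inT T s, inN T x⁆ = ⁅inT T t, inN T x⁆) → s = t := by
    intro s t h
    refine Subtype.ext (LieDerivation.ext fun x => ?_)
    have := h x
    rw [lie_inT_inN, lie_inT_inN] at this
    exact LieAlgebra.SemiDirectSum.inl_injective T.incl this
  let φ' : T →ₗ[ℂ] T :=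
    { toFun := φ
      map_add' := fun s t => hφ_eq _ _ fun x => by
        rw [← hφ, map_add (inT T), map_add (inT T), ev_add_left, LinearMap.add_apply, hφ, hφ,
          add_lie]
      map_smul' := fun c t => hφ_eq _ _ fun x => by
        rw [← hφ, RingHom.id_apply, map_smul (inT T), map_smul (inT T), ev_smul_left,
          LinearMap.smul_apply, hφ, smul_lie] }
  let fN : N →ₗ[ℂ] N →ₗ[ℂ] SolvExt T :=
    (toBilin (SolvExt T) (SolvExt T) f).compl₁₂ (inN T : N →ₗ[ℂ] SolvExt T)
      (inN T : N →ₗ[ℂ] SolvExt T)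
  have hfN : IsInvariantCocycle T fN :=
    { self_eq_zero := fun x => ev_self f _
      invariant := fun t x y => by
        change ⁅inT T t, f (inN T x) (inN T y)⁆ = f (inN T _) (inN T y) + f (inN T x) (inN T _)
        rw [hinv, lie_inT_inN, lie_inT_inN]
      cocycle := fun x y z => by
        have h := hf (inN T x) (inN T y) (inN T z)
        rw [← LieHom.map_lie, ← LieHom.map_lie, ← LieHom.map_lie] at h
        exact h }
  obtain ⟨g, hg, hfg⟩ := hfN.exists_eq_coboundary hT hW (mem_W_or_eq_zero htor)
  have hfg' : ∀ x y : N, f (inN T x) (inN T y) =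
      ⁅inN T x, g y⁆ - ⁅inN T y, g x⁆ - g ⁅x, y⁆ := LinearMap.congr_fun₂ hfg
  let G : SolvExt T →ₗ[ℂ] SolvExt T :=
    g.comp (LieAlgebra.SemiDirectSum.projl T.incl) +
      ((inT T : T →ₗ[ℂ] SolvExt T).comp φ').comp
        (LieAlgebra.SemiDirectSum.projr T.incl : SolvExt T →ₗ[ℂ] T)
  have hGN : ∀ x, G (inN T x) = g x := fun x => by
    change g x + inT T (φ' 0) = g x
    rw [map_zero, map_zero, add_zero]
  have hGT : ∀ t, G (inT T t) = inT T (φ t) := fun t => by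
    change g 0 + inT T (φ t) = _
    rw [map_zero, zero_add]
  let dG : C2 (SolvExt T) (SolvExt T) := d₁₂ ℂ (SolvExt T) (SolvExt T) G
  have hdG : ∀ r s, dG r s = ⁅r, G s⁆ - ⁅s, G r⁆ - G ⁅r, s⁆ := fun _ _ => rfl
  have hdTN : ∀ (t : T) (x : N), dG (inT T t) (inN T x) = f (inT T t) (inN T x) := fun t x => by
    rw [hdG, hGN, hGT, lie_inT_inN, hGN, hg t x, hφ, ← lie_skew (inT T (φ t))]
    abel
  refine ⟨G, C2.ext' fun r s => ?_⟩
  change dG r s = f r s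
  rw [eq_inN_add_inT r, eq_inN_add_inT s, ev_add_left, ev_add_left, LinearMap.add_apply,
    LinearMap.add_apply, LinearMap.map_add, LinearMap.map_add, LinearMap.map_add,
    LinearMap.map_add, hdTN,
    ev_skew dG (inN T r.left) (inT T s.right), hdTN, ← ev_skew f]
  congr 2
  · rw [hdG, hGN, hGN, ← LieHom.map_lie, hGN, hfg']
  · rw [hdG, hGT, hGT, lie_inT_inT htor, lie_inT_inT htor, lie_inT_inT htor, hTT, sub_self,
      map_zero, sub_zero]

theorem cohomologicallyRigid_solvExt (hT : IsMaxRank T)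
    (hW : ∀ l ∈ W T, LegerLuks T l ∨ UniqueDecomposition T l ∨ ShortWeight T l) :
    CohomologicallyRigid (SolvExt T) := by
  have htor := hT.isTorus
  have := hT.finiteDimensional_torus
  have : FiniteDimensional ℂ (SolvExt T) :=
    Module.Finite.equiv (LieAlgebra.SemiDirectSum.toProdl T.incl).symm
  have hact := isSemisimple_moduleEnd (isDiagonalModule_solvExt htor)
  have hZB : ∀ (t : T), ∀ v ∈ (Z2 (SolvExt T) (SolvExt T)).map (toBilin _ _),
      bilinAct (moduleEnd T (SolvExt T)) (moduleEnd T (SolvExt T)) t v ∈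
        (B2 (SolvExt T) (SolvExt T)).map (toBilin _ _) := by
    rintro t _ ⟨f, hf, rfl⟩
    exact ⟨_, ⟨f (inT T t), rfl⟩, (bilinAct_cocycle hf t).symm⟩
  have hBZ : (B2 (SolvExt T) (SolvExt T)).map (toBilin _ _) ≤
      (Z2 (SolvExt T) (SolvExt T)).map (toBilin _ _) := Submodule.map_mono (B2_le_Z2 _)
  refine Submodule.Quotient.subsingleton_iff.2 (eq_top_iff.2 fun ⟨f, hf⟩ _ => ?_)
  change f ∈ B2 (SolvExt T) (SolvExt T)
  have hfm : toBilin _ _ f ∈ (Z2 (SolvExt T) (SolvExt T)).map (toBilin _ _) :=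
    Submodule.mem_map_of_mem hf
  obtain ⟨_, ⟨g, hg, rfl⟩, hg0, h, hh, hhg⟩ := exists_annihilated_sub_mem
    (bilinAct (moduleEnd T (SolvExt T)) (moduleEnd T (SolvExt T)))
    (commute_bilinAct (commute_moduleEnd htor) (commute_moduleEnd htor))
    (fun t => isSemisimple_bilinAct (hact t) (hact t))
    (fun t v hv => hBZ (hZB t v hv)) (fun t v hv => hZB t v (hBZ hv)) hfm
    (fun t => hZB t _ hfm)
  rw [← map_sub] at hhg
  have hfg : f - g ∈ B2 (SolvExt T) (SolvExt T) := toBilin_injective _ _ hhg ▸ hh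
  have hgB : g ∈ B2 (SolvExt T) (SolvExt T) := mem_B2_of_invariant hT hW hg fun t r s => by
    have := LinearMap.congr_fun₂ (hg0 t) r s
    rw [bilinAct_apply, sub_sub] at this
    exact sub_eq_zero.1 this
  have := Submodule.add_mem _ hfg hgB
  rwa [sub_add_cancel] at this

end Rigidity

end MaxRank

theorem theorem3p2 {N : Type*} [LieRing N] [LieAlgebra ℂ N] [FiniteDimensional ℂ N]
    (T : LieSubalgebra ℂ (LieDerivation ℂ N N)) (hT : MaxRank.IsMaxRank T)
    (hW : ∀ l ∈ MaxRank.W T,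
      MaxRank.LegerLuks T l ∨ MaxRank.UniqueDecomposition T l ∨ MaxRank.ShortWeight T l) :
    (∀ (M : Type*) [AddCommGroup M] [Module ℂ M] [FiniteDimensional ℂ M]
        [LieRingModule (MaxRank.SolvExt T) M] [LieModule ℂ (MaxRank.SolvExt T) M],
        MaxRank.IsDiagonalModule T M → MaxRank.WeightsIn T M → MaxRank.H2Inv T M = ⊥) ∧
      MaxRank.CohomologicallyRigid (MaxRank.SolvExt T) :=
  ⟨fun _ _ _ _ _ _ hM hMW => MaxRank.H2Inv_eq_bot hT hW hM hMW,
    MaxRank.cohomologicallyRigid_solvExt hT hW⟩
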